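/- Let $\Gamma$ be a lattice of rank $m$ with an integral skew-symmetric form $\langle-,-\rangle$, let $\gamma_1,\dots,\gamma_m$ be a basis of $\Gamma$, let $\Gamma_{\ge 0}=\bigoplus_i\mathbb{Z}_{\ge0}\gamma_i$ and $\Gamma_{>0}=\Gamma_{\ge0}\setminus\{0\}$, and for $\alpha=\sum_i\alpha_i\gamma_i$ put $\deg\alpha=\sum_i\alpha_i$. Let $\widehat{\mathfrak g}=\mathbb{C}[[s_1,\dots,s_m]]$, where $s_i=e_{\gamma_i}$ and $e_\alpha={\bf s}^\alpha$ for $\alpha\in\Gamma_{\ge0}$, so that $e_\alpha e_\beta=e_{\alpha+\beta}$; write $\partial_i=\partial/\partial s_i$, $[{\bf s}^\alpha]$ for the coefficient of ${\bf s}^\alpha$, and $\exp$ for the exponential of the commutative algebra $\widehat{\mathfrak g}$. Let $(Z,a)$ be stability data: a homomorphism $Z:\Gamma\to\mathbb{C}$ and elements $a(\gamma)=-\mathrm{DT}(\gamma)e_\gamma$, $\mathrm{DT}(\gamma)\in\mathbb{Q}$, $\gamma\neq0$, with the support property $\|\gamma\|\le K|Z(\gamma)|$ whenever $a(\gamma)\ne0$,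 for some norm on $\Gamma\otimes\mathbb{C}$ and some $K>0$. Suppose that $(Z,a)$ is positive ($a(\gamma)\neq 0$ implies $\gamma\in\Gamma_{\ge0}$) and generic (if $a(\gamma),a(\eta)\ne0$ and $\ell_\gamma=\ell_\eta$, where $\ell_\gamma=-\mathbb{R}_{>0}Z(\gamma)$, then $\langle\gamma,\eta\rangle=0$). Put $$L(z)(\alpha)=\frac{Z(\alpha)}{z}+z\,\overline{Z(\alpha)},\qquad X^0(z)(e_\alpha)=e^{L(z)(\alpha)}e_\alpha,\qquad \rho(z,z')=\frac1{4\pi i}\frac{z'+z}{z'-z}.$$ For a finite rooted tree $T$, with vertices $v$ decorated by $\alpha(v)\in\Gamma$, root label $\gamma_T$, set of edges $T^1$ (directed away from the root) and automorphism group $\mathrm{Aut}(T)$ as a decorated rooted tree, put $$W_T=(-1)^{|T^1|}\frac{\mathrm{DT}(\gamma_T)\gamma_T}{|\mathrm{Aut}(T)|}\prod_{v\to w}\langle\alpha(v),\mathrm{DT}(\alpha(w))\alpha(w)\rangle\in\Gamma\otimes\mathbb{Q},$$ $$G_T(z)=\int_{\ell_{\gamma_T}}\frac{dz'}{z'}\rho(z,z')\,X^0(z')(e_{\gamma_T})\prod_{T'}G_{T'}(z'),$$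 where $T'$ runs over the trees obtained by removing the root of $T$ and $\ell_{\gamma_T}$ is oriented from $0$ to $\infty$. Sums over $T$ are over isomorphism classes of decorated rooted trees. Let $$\Phi_i({\bf s})=L(z)(\gamma_i)-\sum_T\langle\gamma_i,W_T\rangle G_T(z)\in\mathbb{C}[[{\bf s}]],$$ and let $X(z)$ be the (continuous) algebra endomorphism of $\widehat{\mathfrak g}$ with $X(z)(s_i)=s_i\exp(\Phi_i)$. Then, for every $T$ with $W_T\neq0$, the integral defining $G_T(z)$ converges and is holomorphic in $z\in\mathbb{C}^*\setminus\ell_{\gamma_T}$, and the sums over $T$ are finite in each coefficient. For every $z\in\mathbb{C}^*$, $X(z)$ is an automorphism of $\widehat{\mathfrak g}$, with $X(z)(e_\alpha)=X^0(z)(e_\alpha)\exp\langle\alpha,-\sum_TW_TG_T(z)\rangle$ for all $\alpha\in\Gamma_{\ge0}$. Let $\mathcal A=(\partial_zX)X^{-1}$. For every $k\ge0$ and every $z\in\mathbb{C}^*$ outside the rays $\ell_\gamma$ with $a(\gamma)\ne0$ and $\deg\gamma\le k$, the following holds modulo terms of degree $>k$ in ${\bf s}$: $X$ is holomorphic at $z$,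 $\mathcal A=\sum_{i=1}^m\mathcal A(e_{\gamma_i})\partial_i$, and for $i=1,\dots,m$ $$\mathcal A(e_{\gamma_i})=\sum_{\alpha\in\Gamma_{>0}}\Big([{\bf s}^\alpha]\ \det\big(\delta_{pq}+s_p\,\partial_q\Phi_p({\bf s})\big)\,s_i\,\exp\Big(-\sum_j\alpha_j\Phi_j({\bf s})\Big)\Big)\;X(z)(e_\alpha)\Big(\partial_zL(z)(\alpha)-\sum_T\langle\alpha,W_T\rangle\,\partial_zG_T(z)\Big).$$ -/

import Mathlib

open MeasureTheory MvPowerSeries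
open scoped TensorProduct BigOperators

noncomputable section

/-! ### The lattice, its positive cone, and the completed algebra

A basis `b = (γ₁, …, γₘ)` of the lattice `Γ` is fixed. The cone `Γ_{≥0}` consists of the
non-negative combinations of the `γᵢ`. The commutative algebra `ĝ` is the completion of the
span of the symbols `e_γ`, `γ ∈ Γ_{≥0}`, with product `e_γ * e_η = e_{γ+η}`; writing
`sᵢ = e_{γᵢ}` it is the ring `ℂ[[s₁, …, sₘ]]`, i.e. `MvPowerSeries (Fin m) ℂ`, and
`g_{≤k}` is its quotient by the series all of whose monomials have degree `> k`. -/

/-- The cone `Γ_{≥0}`. -/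
def posCone {Γ : Type*} [AddCommGroup Γ] {m : ℕ} (b : Module.Basis (Fin m) ℤ Γ) :
    AddSubmonoid Γ where
  carrier := {γ | ∀ i, 0 ≤ b.repr γ i}
  zero_mem' := by intro i; simp
  add_mem' := by
    intro x y hx hy i
    simpa using add_nonneg (hx i) (hy i)

/-- The degree of `γ`: the sum of its coordinates. -/
def latticeDegree {Γ : Type*} [AddCommGroup Γ] {m : ℕ} (b : Module.Basis (Fin m) ℤ Γ)
    (γ : Γ) : ℤ :=
  ∑ i, b.repr γ i

/-- The exponent vector of `γ ∈ Γ_{≥0}`. -/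
def exponent {Γ : Type*} [AddCommGroup Γ] {m : ℕ} (b : Module.Basis (Fin m) ℤ Γ) (γ : Γ) :
    Fin m →₀ ℕ :=
  (b.repr γ).mapRange Int.toNat Int.toNat_zero

open Classical in
/-- The element `e_γ = s^γ` of `ĝ` for `γ ∈ Γ_{≥0}` (by convention `0` outside the cone). -/
def eElem {Γ : Type*} [AddCommGroup Γ] {m : ℕ} (b : Module.Basis (Fin m) ℤ Γ) (γ : Γ) :
    MvPowerSeries (Fin m) ℂ :=
  if γ ∈ posCone b then monomial (exponent b γ) (1 : ℂ) else 0

/-- `exp_*` on `ĝ`: the exponential series `∑ fⁿ / n!` for the commutative product. The constant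
term `c` of `f` is split off: `exp_* f = exp c · exp_* (f - c)`, and the last factor is a
substitution into the formal exponential series. -/
def expStar {m : ℕ} (f : MvPowerSeries (Fin m) ℂ) : MvPowerSeries (Fin m) ℂ :=
  C (Complex.exp (constantCoeff f)) *
    PowerSeries.subst (f - C (constantCoeff f)) (PowerSeries.exp ℂ)

/-- The derivative in `z` of a `ĝ`-valued function, taken coefficient by coefficient. -/
def derivCoeff {m : ℕ} (F : ℂ → MvPowerSeries (Fin m) ℂ) (z : ℂ) : MvPowerSeries (Fin m) ℂ :=
  fun β => deriv (fun w => coeff β (F w)) z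

/-! ### Decorated rooted trees -/

/-- Finite rooted trees with vertices decorated by elements of `Γ`, together with an ordering of
the children of each vertex: `node γ n c` has root label `γ`, and removing the root leaves the
trees `c 0, …, c (n-1)`. -/
inductive OrderedTree (Γ : Type*) : Type _
  | node (γ : Γ) (n : ℕ) (c : Fin n → OrderedTree Γ) : OrderedTree Γ

namespace OrderedTree

variable {Γ : Type*}

/-- Isomorphisms of decorated rooted trees (the orderings are not respected): the root labels
agree, and there are a bijection between the children of the roots and isomorphisms of the
corresponding subtrees. -/
def Isom : OrderedTree Γ → OrderedTree Γ → Type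
  | node γ n c, node γ' n' c' =>
      PLift (γ = γ') × (Σ σ : Fin n ≃ Fin n', ∀ i, Isom (c i) (c' (σ i)))

theorem isom_refl : ∀ T : OrderedTree Γ, Nonempty (Isom T T)
  | node _ _ c => ⟨⟨⟨rfl⟩, Equiv.refl _, fun i => (isom_refl (c i)).some⟩⟩

theorem isom_symm : ∀ T T' : OrderedTree Γ, Nonempty (Isom T T') → Nonempty (Isom T' T)
  | node γ n c, node γ' n' c', ⟨⟨⟨h⟩, σ, f⟩⟩ =>
      ⟨⟨⟨h.symm⟩, σ.symm, fun j => (isom_symm (c (σ.symm j)) (c' j) (by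
        have g := f (σ.symm j)
        rw [Equiv.apply_symm_apply] at g
        exact ⟨g⟩)).some⟩⟩

theorem isom_trans : ∀ T T' T'' : OrderedTree Γ,
    Nonempty (Isom T T') → Nonempty (Isom T' T'') → Nonempty (Isom T T'')
  | node _ _ c, node _ _ c', node _ _ c'', ⟨⟨⟨h⟩, σ, f⟩⟩, ⟨⟨⟨h'⟩, σ', f'⟩⟩ =>
      ⟨⟨⟨h.trans h'⟩, σ.trans σ', fun i =>
        (isom_trans (c i) (c' (σ i)) (c'' (σ' (σ i))) ⟨f i⟩ ⟨f' (σ i)⟩).some⟩⟩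

/-- Being isomorphic as decorated rooted trees. -/
def isoSetoid (Γ : Type*) : Setoid (OrderedTree Γ) where
  r T T' := Nonempty (Isom T T')
  iseqv := ⟨isom_refl, fun {T T'} h => isom_symm T T' h, fun {T T' T''} h h' =>
    isom_trans T T' T'' h h'⟩

/-- The label `γ_T` of the root. -/
def rootLabel : OrderedTree Γ → Γ
  | node γ _ _ => γ

/-- The number of edges `|T¹|`. -/
def numEdges : OrderedTree Γ → ℕ
  | node _ _ c => ∑ i, (1 + numEdges (c i))

/-- The order of the group of automorphisms of the decorated rooted tree `T`. -/
def autCard (T : OrderedTree Γ) : ℕ := Nat.card (Isom T T)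

/-- The product over the edges `v → w` of `T`, directed away from the root, of
`F (α v) (α w)`, where `α v` is the label of `v`. -/
def edgeProd (F : Γ → Γ → ℚ) : OrderedTree Γ → ℚ
  | node γ _ c => ∏ i, (F γ (rootLabel (c i)) * edgeProd F (c i))

end OrderedTree

/-- Isomorphism classes of finite rooted trees decorated by `Γ`. -/
def DecTree (Γ : Type*) : Type _ := Quotient (OrderedTree.isoSetoid Γ)

/-- A representative of an isomorphism class; everything below is invariant under isomorphism. -/
def DecTree.rep {Γ : Type*} (T : DecTree Γ) : OrderedTree Γ := Quotient.out T

/-- The sum over all decorated rooted trees of a family of elements of `ĝ`, coefficient by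
coefficient (each coefficient receives finitely many contributions in the sums used below). -/
def treeSum {Γ : Type*} {m : ℕ} (F : DecTree Γ → MvPowerSeries (Fin m) ℂ) :
    MvPowerSeries (Fin m) ℂ :=
  fun β => ∑ᶠ T : DecTree Γ, coeff β (F T)

/-! ### Stability data -/

/-- Stability data `(Z, a)`. Since the degree `γ` part of the graded Lie algebra is spanned by
`e_γ`, the element `a(γ)` is recorded by its coordinate, a rational number. The map `a` matters on
`Γ ∖ {0}` only, and `a 0 = 0` by convention. The last field is the support property for some
(equivalently any) norm on `Γ ⊗ ℂ`. -/
structure StabilityData (Γ : Type*) [AddCommGroup Γ] where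
  Z : Γ →+ ℂ
  a : Γ → ℚ
  a_zero : a 0 = 0
  support : ∃ N : Seminorm ℂ (ℂ ⊗[ℤ] Γ), (∀ x, N x = 0 → x = 0) ∧
    ∃ K : ℝ, 0 < K ∧ ∀ γ, a γ ≠ 0 → N ((1 : ℂ) ⊗ₜ[ℤ] γ) ≤ K * ‖Z γ‖

namespace StabilityData

variable {Γ : Type*} [AddCommGroup Γ] {m : ℕ}
  (S : StabilityData Γ) (b : Module.Basis (Fin m) ℤ Γ) (form : Γ →ₗ[ℤ] Γ →ₗ[ℤ] ℤ)

/-- `DT(γ) e_γ = - a(γ)`. -/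
def DT (γ : Γ) : ℚ := - S.a γ

/-- The ray `ℓ_γ = - ℝ_{>0} Z(γ)`. -/
def ray (γ : Γ) : Set ℂ := {w | ∃ t : ℝ, 0 < t ∧ w = -(t : ℂ) * S.Z γ}

/-- Positivity: `a` is supported in the cone `Γ_{≥0}`. -/
def IsPositive : Prop := ∀ γ, S.a γ ≠ 0 → γ ∈ posCone b

/-- Genericity: active charges with the same ray pair to zero. -/
def IsGeneric : Prop :=
  ∀ γ η, S.a γ ≠ 0 → S.a η ≠ 0 → S.ray γ = S.ray η → form γ η = 0

/-- `L(z)(γ) = Z(γ) / z + z \bar Z(γ)`. -/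
def L (z : ℂ) (γ : Γ) : ℂ := S.Z γ / z + z * (starRingEnd ℂ) (S.Z γ)

/-- The base point `X⁰(z)(e_γ) = exp(L(z)(γ)) e_γ`. -/
def X0 (z : ℂ) (γ : Γ) : MvPowerSeries (Fin m) ℂ :=
  C (Complex.exp (S.L z γ)) * eElem b γ

/-- The kernel `ρ(z, z') = (1 / 4πi) (z' + z) / (z' - z)`. -/
def rho (z z' : ℂ) : ℂ := 1 / (4 * Real.pi * Complex.I) * ((z' + z) / (z' - z))

/-- The integral `∫_{ℓ_γ} (dz'/z') ρ(z, z') F(z')` is computed with the parametrisation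
`z' = - t Z(γ)`, `t > 0`, for which `dz'/z' = dt/t`; this is the resulting integrand. -/
def rayIntegrand (γ : Γ) (F : ℂ → ℂ) (z : ℂ) (t : ℝ) : ℂ :=
  (t : ℂ)⁻¹ * rho z (-(t : ℂ) * S.Z γ) * F (-(t : ℂ) * S.Z γ)

/-- The propagator
`G_T(z) = ∫_{ℓ_{γ_T}} (dz'/z') ρ(z, z') X⁰(z')(e_{γ_T}) ∏_{T'} G_{T'}(z')`, where `T'` runs over
the trees obtained by removing the root of `T`; a `ĝ`-valued integral, taken coefficientwise. -/
def propagator : OrderedTree Γ → ℂ → MvPowerSeries (Fin m) ℂ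
  | .node γ _ c => fun z β => ∫ t in Set.Ioi (0 : ℝ),
      S.rayIntegrand γ (fun w => coeff β (S.X0 b w γ * ∏ i, propagator (c i) w)) z t

/-- The integrand in the coefficient of `s^β` in `G_T(z)`. -/
def propagatorIntegrand : OrderedTree Γ → (Fin m →₀ ℕ) → ℂ → ℝ → ℂ
  | .node γ _ c, β, z, t =>
      S.rayIntegrand γ (fun w => coeff β (S.X0 b w γ * ∏ i, S.propagator b (c i) w)) z t

/-- `G_T(z)`. -/
def G (T : DecTree Γ) (z : ℂ) : MvPowerSeries (Fin m) ℂ := S.propagator b T.rep z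

/-- The weight `W_T = (-1)^{|T¹|} DT(γ_T) γ_T / |Aut T| · ∏_{v → w} ⟨α(v), DT(α(w)) α(w)⟩`
in `Γ ⊗ ℚ`. -/
def W (T : DecTree Γ) : Γ ⊗[ℤ] ℚ :=
  T.rep.rootLabel ⊗ₜ[ℤ]
    ((-1) ^ T.rep.numEdges * S.DT T.rep.rootLabel / T.rep.autCard *
      T.rep.edgeProd (fun v w => (form v w : ℚ) * S.DT w))

/-- The `ℚ`-linear extension of `⟨α, -⟩` to `Γ ⊗ ℚ`. -/
def pairQ (α : Γ) (x : Γ ⊗[ℤ] ℚ) : ℚ :=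
  TensorProduct.lid ℤ ℚ ((form α).rTensor ℚ x)

/-- `∑_T ⟨α, W_T⟩ G_T(z)`. -/
def treeTerm (α : Γ) (z : ℂ) : MvPowerSeries (Fin m) ℂ :=
  treeSum fun T => (pairQ form α (S.W form T) : ℂ) • S.G b T z

/-- `∑_T ⟨α, W_T⟩ ∂_z G_T(z)`. -/
def treeTermDeriv (α : Γ) (z : ℂ) : MvPowerSeries (Fin m) ℂ :=
  treeSum fun T => (pairQ form α (S.W form T) : ℂ) • derivCoeff (S.G b T) z

/-- `Φ_i = L(z)(γ_i) - ∑_T ⟨γ_i, W_T⟩ G_T(z)`. -/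
def Phi (z : ℂ) (i : Fin m) : MvPowerSeries (Fin m) ℂ :=
  C (S.L z (b i)) - S.treeTerm b form (b i) z

theorem hasSubst_mul_expStar (Φ : Fin m → MvPowerSeries (Fin m) ℂ) :
    HasSubst (fun i => (MvPowerSeries.X i : MvPowerSeries (Fin m) ℂ) * expStar (Φ i)) :=
  hasSubst_of_constantCoeff_zero fun i => by simp

/-- The flat section `X(z)`: the (continuous) algebra endomorphism of `ĝ` with
`s_i ↦ s_i exp_*(Φ_i)`. -/
def X (z : ℂ) : MvPowerSeries (Fin m) ℂ →ₐ[ℂ] MvPowerSeries (Fin m) ℂ :=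
  substAlgHom (hasSubst_mul_expStar (S.Phi b form z))

/-- The linear map `∂_z X(z)`: `f ↦ ∂_z (X(z)(f))`. -/
def dX (z : ℂ) (f : MvPowerSeries (Fin m) ℂ) : MvPowerSeries (Fin m) ℂ :=
  derivCoeff (fun w => S.X b form w f) z

/-- The connection form `A(z) = (∂_z X(z)) X(z)⁻¹`. -/
def A (z : ℂ) (f : MvPowerSeries (Fin m) ℂ) : MvPowerSeries (Fin m) ℂ :=
  S.dX b form z (Function.invFun (S.X b form z) f)

/-- `[s^α] ( det(δ_{pq} + s_p ∂_q Φ_p) s_i exp_*(- ∑_j α_j Φ_j) )`. -/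
def goodCoeff (z : ℂ) (i : Fin m) (α : Γ) : ℂ :=
  coeff (exponent b α)
    (Matrix.det (Matrix.of fun p q : Fin m =>
        (if p = q then 1 else 0) + MvPowerSeries.X p * pderiv ℂ q (S.Phi b form z p)) *
      MvPowerSeries.X i * expStar (- ∑ j, (b.repr α j : ℂ) • S.Phi b form z j))

end StabilityData

end

/-! ### The exponential of a power series -/

section Exponential

variable {m : ℕ}

/-! The algebra rests on additivity: the map sending `α` to `L(z)(α) - ∑_T ⟨α, W_T⟩ G_T(z)` is a
homomorphism `logX`, so X(z) multiplies `e_α` by the exponential of `logX` at `α`. Any endomorphism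
`s_i ↦ s_i exp Φ_i` is triangular for the componentwise order of exponents, with nonzero diagonal,
hence bijective (`expEndo_bijective`).

The analysis is an induction on trees. A nonzero weight forces every label to be active and adjacent
labels to pair nontrivially, so by genericity the rays of parent and child are distinct. A
propagator is therefore evaluated, inside its parent's integral, only on a ray where it is
holomorphic and bounded, while `exp L(z')` decays at both ends of the parent's ray
(`IsAdmissible.isRegular`). Each `G_T` is a single monomial whose exponent is the sum of the labels;
by positivity only finitely many trees have a given exponent (`finite_isAdmissible`).

For the connection, differentiating X(e_α) gives X(e_α) ∂_z log X(e_α). Expanding X⁻¹(s_i) in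
monomials and applying ∂_z X term by term gives the formula for A(s_i), and the Lagrange–Good
formula (`coeff_eq_coeff_det_mul_expEndo`) computes the coefficients of X⁻¹(s_i). Differentiating
X(fg) = X(f) X(g) shows that A is a derivation modulo high degree, hence determined by its values on
the generators (`coeff_A`). -/

theorem coeff_pow_eq_zero_of_degree_lt {f : MvPowerSeries (Fin m) ℂ} (hf : constantCoeff f = 0)
    {β : Fin m →₀ ℕ} {n : ℕ} (h : β.degree < n) : coeff β (f ^ n) = 0 :=
  coeff_eq_zero_of_constantCoeff_nilpotent (m := 1) (by simpa using hf) (by omega)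

/-- The truncated exponential series. -/
noncomputable def expTrunc (N : ℕ) (f : MvPowerSeries (Fin m) ℂ) : MvPowerSeries (Fin m) ℂ :=
  ∑ n ∈ Finset.range N, C ((n.factorial : ℂ)⁻¹) * f ^ n

/-- The n-th power of a series without constant term starts in degree n, so only finitely many terms
of the exponential series reach a given coefficient. -/
theorem coeff_subst_exp {f : MvPowerSeries (Fin m) ℂ} (hf : constantCoeff f = 0)
    {β : Fin m →₀ ℕ} {N : ℕ} (hN : β.degree < N) :
    coeff β (PowerSeries.subst f (PowerSeries.exp ℂ)) = coeff β (expTrunc N f) := by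
  rw [PowerSeries.coeff_subst (PowerSeries.HasSubst.of_constantCoeff_zero hf),
    finsum_eq_sum_of_support_subset (s := Finset.range N)]
  · simp [expTrunc, PowerSeries.coeff_exp, coeff_C_mul]
  · intro n hn
    by_contra h
    simp only [Finset.coe_range, Set.mem_Iio, not_lt] at h
    exact hn (by
      simp only [coeff_pow_eq_zero_of_degree_lt hf (hN.trans_le h), smul_zero])

theorem coeff_mul_congr_of_degree_le {P Q R : MvPowerSeries (Fin m) ℂ} {k : ℕ}
    (h : ∀ β : Fin m →₀ ℕ, β.degree ≤ k → coeff β Q = coeff β R)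
    {β : Fin m →₀ ℕ} (hβ : β.degree ≤ k) : coeff β (P * Q) = coeff β (P * R) := by
  classical
  rw [coeff_mul, coeff_mul]
  refine Finset.sum_congr rfl fun x hx => ?_
  rw [h]
  have := congrArg Finsupp.degree (Finset.HasAntidiagonal.mem_antidiagonal.1 hx)
  simp only [map_add] at this
  omega

theorem sum_inv_factorial_mul_pow_pred (N : ℕ) (f g : MvPowerSeries (Fin m) ℂ) :
    ∑ n ∈ Finset.range (N + 1), C ((n.factorial : ℂ)⁻¹) *
        ((n : MvPowerSeries (Fin m) ℂ) * f ^ (n - 1) * g) =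
      g * expTrunc N f := by
  rw [expTrunc, Finset.sum_range_succ', Finset.mul_sum]
  simp only [Nat.factorial_succ, add_tsub_cancel_right, Nat.cast_zero, zero_mul, mul_zero, add_zero]
  refine Finset.sum_congr rfl fun n _ => ?_
  have : ((n + 1 : ℕ) : MvPowerSeries (Fin m) ℂ) = C ((n + 1 : ℕ) : ℂ) := by simp
  rw [this]
  have h : C (((n + 1) * n.factorial : ℕ) : ℂ)⁻¹ * C ((n + 1 : ℕ) : ℂ) =
      (C ((n.factorial : ℂ)⁻¹) : MvPowerSeries (Fin m) ℂ) := by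
    rw [← map_mul]
    congr 1
    have : ((n : ℂ) + 1) ≠ 0 := by exact_mod_cast Nat.succ_ne_zero n
    have : (n.factorial : ℂ) ≠ 0 := by exact_mod_cast n.factorial_ne_zero
    push_cast
    field_simp
  linear_combination (f ^ n * g) * h

theorem pderiv_expTrunc (q : Fin m) (N : ℕ) (f : MvPowerSeries (Fin m) ℂ) :
    pderiv ℂ q (expTrunc (N + 1) f) = pderiv ℂ q f * expTrunc N f := by
  rw [← sum_inv_factorial_mul_pow_pred, expTrunc, map_sum]
  simp only [Derivation.leibniz, pderiv_C, pderiv_pow, smul_eq_mul, mul_zero, add_zero]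

theorem pderiv_subst_exp {f : MvPowerSeries (Fin m) ℂ} (hf : constantCoeff f = 0) (q : Fin m) :
    pderiv ℂ q (PowerSeries.subst f (PowerSeries.exp ℂ)) =
      pderiv ℂ q f * PowerSeries.subst f (PowerSeries.exp ℂ) := by
  ext β
  rw [coeff_mul_congr_of_degree_le (R := expTrunc (β.degree + 1) f) (k := β.degree)
    (fun γ hγ => coeff_subst_exp hf (by omega)) le_rfl, ← pderiv_expTrunc, coeff_pderiv,
    coeff_pderiv, coeff_subst_exp hf]
  simp

theorem constantCoeff_subst_exp {f : MvPowerSeries (Fin m) ℂ} (hf : constantCoeff f = 0) :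
    constantCoeff (PowerSeries.subst f (PowerSeries.exp ℂ)) = 1 := by
  rw [← coeff_zero_eq_constantCoeff_apply, coeff_subst_exp hf (N := 1) (by simp)]
  simp [expTrunc]

theorem constantCoeff_sub_C (f : MvPowerSeries (Fin m) ℂ) :
    constantCoeff (f - C (constantCoeff f)) = 0 := by simp

@[simp]
theorem constantCoeff_expStar (f : MvPowerSeries (Fin m) ℂ) :
    constantCoeff (expStar f) = Complex.exp (constantCoeff f) := by
  rw [expStar, map_mul, constantCoeff_subst_exp (constantCoeff_sub_C f)]
  simp

theorem coeff_expStar (f : MvPowerSeries (Fin m) ℂ) {β : Fin m →₀ ℕ} {N : ℕ}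
    (hN : β.degree < N) :
    coeff β (expStar f) =
      coeff β (C (Complex.exp (constantCoeff f)) * expTrunc N (f - C (constantCoeff f))) := by
  rw [expStar, coeff_C_mul, coeff_C_mul, coeff_subst_exp (constantCoeff_sub_C f) hN]

theorem pderiv_expStar (f : MvPowerSeries (Fin m) ℂ) (q : Fin m) :
    pderiv ℂ q (expStar f) = pderiv ℂ q f * expStar f := by
  rw [expStar, Derivation.leibniz, pderiv_C, pderiv_subst_exp (constantCoeff_sub_C f), map_sub,
    pderiv_C]
  simp only [smul_eq_mul]
  ring

@[simp]
theorem expStar_zero : expStar (0 : MvPowerSeries (Fin m) ℂ) = 1 :=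
  pderiv.ext (fun i => by simp [pderiv_expStar]) (by simp)

/-- In characteristic zero a series is determined by its constant term and its partial derivatives;
this replaces any rearrangement of exponential series here and in `expStar_add`. -/
theorem expStar_mul_neg (f : MvPowerSeries (Fin m) ℂ) : expStar f * expStar (-f) = 1 := by
  refine pderiv.ext (fun i => ?_) (by simp [← Complex.exp_add])
  simp only [Derivation.leibniz, pderiv_expStar, smul_eq_mul, map_neg, pderiv_one]
  ring

theorem expStar_add (f g : MvPowerSeries (Fin m) ℂ) :
    expStar (f + g) = expStar f * expStar g := by
  have h : expStar f * expStar g * expStar (-(f + g)) = 1 := by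
    refine pderiv.ext (fun i => ?_) ?_
    · simp only [Derivation.leibniz, pderiv_expStar, smul_eq_mul, map_neg, map_add, pderiv_one]
      ring
    · simp only [map_mul, constantCoeff_expStar, ← Complex.exp_add, map_neg, map_add, map_one]
      simp
  calc expStar (f + g) = expStar (f + g) * (expStar f * expStar g * expStar (-(f + g))) := by
        rw [h, mul_one]
    _ = expStar (f + g) * expStar (-(f + g)) * (expStar f * expStar g) := by ring
    _ = _ := by rw [expStar_mul_neg, one_mul]

theorem expStar_sum {ι : Type*} (s : Finset ι) (f : ι → MvPowerSeries (Fin m) ℂ) :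
    expStar (∑ i ∈ s, f i) = ∏ i ∈ s, expStar (f i) := by
  classical
  induction s using Finset.induction_on with
  | empty => simp
  | insert a s ha ih => rw [Finset.sum_insert ha, Finset.prod_insert ha, expStar_add, ih]

theorem expStar_natCast_smul (n : ℕ) (f : MvPowerSeries (Fin m) ℂ) :
    expStar ((n : ℂ) • f) = expStar f ^ n := by
  induction n with
  | zero => simp
  | succ n ih => rw [Nat.cast_succ, add_smul, expStar_add, ih, one_smul, pow_succ]

theorem expStar_C (c : ℂ) : expStar (C c : MvPowerSeries (Fin m) ℂ) = C (Complex.exp c) :=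
  pderiv.ext (fun i => by simp [pderiv_expStar]) (by simp)

end Exponential

/-! ### The endomorphism `s_i ↦ s_i exp Φ_i` -/

section Endomorphism

variable {m : ℕ}

/-- A linear functional which depends on the coefficients of index `≤ α` only is determined by its
values at the monomials. -/
theorem linearMap_apply_eq_sum_monomial {α : Fin m →₀ ℕ} (φ : MvPowerSeries (Fin m) ℂ →ₗ[ℂ] ℂ)
    (hφ : ∀ f, (∀ μ ≤ α, coeff μ f = 0) → φ f = 0) (f : MvPowerSeries (Fin m) ℂ) :
    φ f = ∑ μ ∈ Finset.Iic α, coeff μ f * φ (monomial μ 1) := by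
  classical
  have h := hφ (f - ∑ μ ∈ Finset.Iic α, coeff μ f • monomial μ 1) fun ν hν => by
    simp only [map_sub, map_sum, coeff_smul, coeff_monomial, mul_ite, mul_one, mul_zero]
    rw [Finset.sum_ite_eq, if_pos (Finset.mem_Iic.2 hν), sub_self]
  rw [map_sub, map_sum, sub_eq_zero] at h
  simpa only [map_smul, smul_eq_mul] using h

theorem coeff_mul_eq_zero_of_le {α : Fin m →₀ ℕ} {f : MvPowerSeries (Fin m) ℂ}
    (hf : ∀ μ ≤ α, coeff μ f = 0) (P : MvPowerSeries (Fin m) ℂ) : coeff α (P * f) = 0 := by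
  classical
  rw [coeff_mul]
  refine Finset.sum_eq_zero fun x hx => ?_
  rw [hf _ (le_of_le_of_eq le_add_self (Finset.HasAntidiagonal.mem_antidiagonal.1 hx)), mul_zero]

/-! ### Triangular operators on power series -/

section Triangular

variable {T : MvPowerSeries (Fin m) ℂ →ₗ[ℂ] MvPowerSeries (Fin m) ℂ}
  {K : (Fin m →₀ ℕ) → (Fin m →₀ ℕ) → ℂ}

/-- Below each exponent there are only finitely many others, so the system is solved coefficient by
coefficient, dividing by the diagonal entry. -/
theorem bijective_of_triangular
    (hT : ∀ f β, coeff β (T f) = ∑ α ∈ Finset.Iic β, coeff α f * K β α)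
    (hK : ∀ β, K β β ≠ 0) : Function.Bijective T := by
  classical
  have hsplit : ∀ f β, coeff β (T f) =
      coeff β f * K β β + ∑ α ∈ Finset.Iio β, coeff α f * K β α := fun f β => by
    rw [hT, ← Finset.Iio_insert, Finset.sum_insert (by simp)]
  constructor
  · rw [injective_iff_map_eq_zero]
    intro f hf
    ext β
    induction β using WellFoundedLT.induction with
    | ind β ih =>
      have h := hsplit f β
      rw [hf, coeff_zero, Finset.sum_eq_zero fun α hα => by
        rw [ih α (Finset.mem_Iio.1 hα), coeff_zero, zero_mul], add_zero] at h
      exact (mul_eq_zero.1 h.symm).resolve_right (hK β)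
  · intro g
    let f : MvPowerSeries (Fin m) ℂ := (wellFounded_lt (α := Fin m →₀ ℕ)).fix fun β F =>
      (coeff β g - ∑ α ∈ (Finset.Iio β).attach, F α (Finset.mem_Iio.1 α.2) * K β α) / K β β
    refine ⟨f, ?_⟩
    ext β
    have hf : coeff β f =
        (coeff β g - ∑ α ∈ (Finset.Iio β).attach, coeff α.1 f * K β α) / K β β := by
      rw [coeff_apply f]
      exact WellFounded.fix_eq _ _ _
    rw [hsplit, hf, div_mul_cancel₀ _ (hK β),
      Finset.sum_attach (Finset.Iio β) fun α => coeff α f * K β α]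
    ring

end Triangular

/-- `∑_j α_j Φ_j`. -/
noncomputable def weightedSum (Φ : Fin m → MvPowerSeries (Fin m) ℂ) (α : Fin m →₀ ℕ) :
    MvPowerSeries (Fin m) ℂ :=
  ∑ j, (α j : ℂ) • Φ j

theorem weightedSum_add (Φ : Fin m → MvPowerSeries (Fin m) ℂ) (α β : Fin m →₀ ℕ) :
    weightedSum Φ (α + β) = weightedSum Φ α + weightedSum Φ β := by
  simp [weightedSum, add_smul, Finset.sum_add_distrib]

/-- The continuous endomorphism with `s_i ↦ s_i exp Φ_i`. -/
noncomputable def expEndo (Φ : Fin m → MvPowerSeries (Fin m) ℂ) :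
    MvPowerSeries (Fin m) ℂ →ₐ[ℂ] MvPowerSeries (Fin m) ℂ :=
  substAlgHom (StabilityData.hasSubst_mul_expStar Φ)

variable (Φ : Fin m → MvPowerSeries (Fin m) ℂ)

theorem prod_mul_expStar_pow (α : Fin m →₀ ℕ) :
    (α.prod fun s e => ((MvPowerSeries.X s : MvPowerSeries (Fin m) ℂ) * expStar (Φ s)) ^ e) =
      monomial α 1 * expStar (weightedSum Φ α) := by
  rw [weightedSum, expStar_sum, Finsupp.prod_fintype _ _ (by simp),
    MvPowerSeries.monomial_one_eq, Finsupp.prod_fintype _ _ (by simp), ← Finset.prod_mul_distrib]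
  simp only [mul_pow, expStar_natCast_smul]

theorem expEndo_monomial (α : Fin m →₀ ℕ) :
    expEndo Φ (monomial α 1) = monomial α 1 * expStar (weightedSum Φ α) := by
  rw [expEndo, substAlgHom_monomial, prod_mul_expStar_pow, map_one, one_mul]

theorem coeff_expEndo (f : MvPowerSeries (Fin m) ℂ) (β : Fin m →₀ ℕ) :
    coeff β (expEndo Φ f) =
      ∑ α ∈ Finset.Iic β, coeff α f * coeff β (expEndo Φ (monomial α 1)) := by
  have h : expEndo Φ f = subst (fun i => MvPowerSeries.X i * expStar (Φ i)) f := by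
    rw [expEndo, ← coe_substAlgHom]
  rw [h, coeff_subst (StabilityData.hasSubst_mul_expStar Φ),
    finsum_eq_sum_of_support_subset (s := Finset.Iic β)]
  · simp only [prod_mul_expStar_pow, expEndo_monomial, smul_eq_mul]
  · intro α hα
    by_contra hle
    simp only [Finset.coe_Iic, Set.mem_Iic] at hle
    apply hα
    simp only [prod_mul_expStar_pow]
    rw [coeff_monomial_mul, if_neg hle, smul_zero]

theorem coeff_expEndo_monomial_self (β : Fin m →₀ ℕ) :
    coeff β (expEndo Φ (monomial β 1)) ≠ 0 := by
  rw [expEndo_monomial, coeff_monomial_mul, if_pos le_rfl, tsub_self,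
    coeff_zero_eq_constantCoeff_apply, constantCoeff_expStar, one_mul]
  exact Complex.exp_ne_zero _

theorem expEndo_bijective : Function.Bijective (expEndo Φ) :=
  bijective_of_triangular (T := (expEndo Φ).toLinearMap) (coeff_expEndo Φ)
    (coeff_expEndo_monomial_self Φ)

theorem coeff_expEndo_eq_zero {α : Fin m →₀ ℕ} {f : MvPowerSeries (Fin m) ℂ}
    (hf : ∀ μ ≤ α, coeff μ f = 0) : ∀ μ ≤ α, coeff μ (expEndo Φ f) = 0 := fun μ hμ => by
  rw [coeff_expEndo]
  exact Finset.sum_eq_zero fun ν hν => by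
    rw [hf ν ((Finset.mem_Iic.1 hν).trans hμ), zero_mul]

end Endomorphism

/-! ### The Lagrange–Good inversion formula -/

section LagrangeGood

variable {m : ℕ} (Φ : Fin m → MvPowerSeries (Fin m) ℂ)

theorem coeff_X_mul_pderiv (q : Fin m) (f : MvPowerSeries (Fin m) ℂ) (l : Fin m →₀ ℕ) :
    coeff l (MvPowerSeries.X q * pderiv ℂ q f) = l q * coeff l f := by
  classical
  rw [X_def, coeff_monomial_mul]
  split_ifs with h
  · rw [coeff_pderiv, tsub_add_cancel_of_le h, one_mul, mul_comm]
    congr 1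
    have : 1 ≤ l q := by simpa using h q
    rw [Finsupp.tsub_apply, Finsupp.single_eq_same, Nat.cast_sub this]
    simp
  · have : l q = 0 := by
      by_contra h0
      refine h fun j => ?_
      by_cases hj : j = q
      · subst hj; simpa using Nat.one_le_iff_ne_zero.2 h0
      · simp [Finsupp.single_eq_of_ne hj]
    simp [this]

/-- The matrix `δ_{pq} + s_p ∂_q Φ_p`. -/
noncomputable def jacobianMatrix : Matrix (Fin m) (Fin m) (MvPowerSeries (Fin m) ℂ) :=
  Matrix.of fun p q => (if p = q then 1 else 0) + MvPowerSeries.X p * pderiv ℂ q (Φ p)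

/-- The two matrices are conjugate by the diagonal matrix of the `s_p`, whose determinant is nonzero
and cancels. The second form is useful because `s_q ∂_q` multiplies the coefficient at `l` by `l q`.
-/
theorem det_jacobianMatrix :
    (jacobianMatrix Φ).det = (Matrix.of fun p q : Fin m =>
      (if p = q then 1 else 0) + MvPowerSeries.X q * pderiv ℂ q (Φ p)).det := by
  set A := (Matrix.of fun p q : Fin m =>
      (if p = q then 1 else 0) + MvPowerSeries.X q * pderiv ℂ q (Φ p))
  let D : Matrix (Fin m) (Fin m) (MvPowerSeries (Fin m) ℂ) :=
    Matrix.diagonal fun p => MvPowerSeries.X p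
  have h : D * A = jacobianMatrix Φ * D := by
    ext1 p q
    simp only [D, A, Matrix.diagonal_mul, Matrix.mul_diagonal, jacobianMatrix, Matrix.of_apply]
    split_ifs with h
    · subst h; ring
    · ring
  have hD : D.det ≠ 0 := by
    rw [Matrix.det_diagonal]
    refine Finset.prod_ne_zero_iff.2 fun i _ hi => ?_
    have := congrArg (coeff (Finsupp.single i 1)) hi
    simp at this
  have h2 := congrArg Matrix.det h
  rw [Matrix.det_mul, Matrix.det_mul, mul_comm] at h2
  exact (mul_right_cancel₀ hD h2).symm

theorem coeff_det (M : Matrix (Fin m) (Fin m) (MvPowerSeries (Fin m) ℂ)) (ν : Fin m →₀ ℕ) :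
    coeff ν M.det = ∑ l ∈ Finset.finsuppAntidiag Finset.univ ν,
      (Matrix.of fun p q => coeff (l p) (M p q)).det := by
  classical
  -- Transposing turns the Leibniz products into products over rows, so that `l` assigns an exponent
  -- to each row.
  have h : ∀ l : Fin m →₀ Fin m →₀ ℕ, (Matrix.of fun p q => coeff (l p) (M p q)).det =
      ∑ σ : Equiv.Perm (Fin m), Equiv.Perm.sign σ • ∏ p, coeff (l p) (M p (σ p)) := fun l => by
    rw [← Matrix.det_transpose, Matrix.det_apply]
    rfl
  rw [← Matrix.det_transpose M, Matrix.det_apply, map_sum, Finset.sum_congr rfl fun l _ => h l,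
    Finset.sum_comm]
  refine Finset.sum_congr rfl fun σ _ => ?_
  simp only [Units.smul_def, map_zsmul, Matrix.transpose_apply, coeff_prod, Finset.smul_sum]

/-- A matrix whose rows outside `P` are multiples of those of a matrix `B` with zero column sums
and zero rows in `P` is singular. -/
theorem det_eq_zero_of_rows {N B : Matrix (Fin m) (Fin m) ℂ} {P : Fin m → Prop}
    (hP : ∃ p, ¬ P p) (hB : ∀ p, P p → B p = 0) (hsum : ∀ q, ∑ p, B p q = 0)
    (hN : ∀ p, ¬ P p → ∃ d : ℂ, N p = d • B p) : N.det = 0 := by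
  classical
  choose! d hd using hN
  by_cases h0 : ∃ p, ¬ P p ∧ d p = 0
  · obtain ⟨p, hp, hdp⟩ := h0
    exact Matrix.det_eq_zero_of_row_eq_zero p fun j => by simp [hd p hp, hdp]
  push Not at h0
  rw [← Matrix.exists_vecMul_eq_zero_iff]
  obtain ⟨p₀, hp₀⟩ := hP
  refine ⟨fun p => if P p then 0 else (d p)⁻¹, fun h => ?_, ?_⟩
  · have := congrFun h p₀
    simp only [if_neg hp₀, Pi.zero_apply, _root_.inv_eq_zero] at this
    exact h0 p₀ hp₀ this
  · ext q
    refine (Finset.sum_congr rfl fun p _ => ?_).trans (hsum q)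
    change (if P p then 0 else (d p)⁻¹) * N p q = B p q
    by_cases hp : P p
    · simp [hp, hB p hp]
    · rw [if_neg hp, hd p hp, Pi.smul_apply, smul_eq_mul, inv_mul_cancel_left₀ (h0 p hp)]

/-- The factor `exp(-ν_p Φ_p)` is absorbed into row `p` and the determinant is expanded over ways of
splitting `ν` into exponents `l p`. Up to a scalar, row `p` of each term is `ν_p δ_{pq} - l_p(q)`.
These rows sum to zero because the `l p` sum to `ν`, so every term is singular when `ν ≠ 0`. -/
theorem coeff_det_jacobianMatrix_mul_expStar (ν : Fin m →₀ ℕ) :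
    coeff ν ((jacobianMatrix Φ).det * expStar (-weightedSum Φ ν)) =
      if ν = 0 then 1 else 0 := by
  classical
  split_ifs with hν
  · subst hν
    have : weightedSum Φ 0 = 0 := by simp [weightedSum]
    rw [this, neg_zero, expStar_zero, mul_one, coeff_zero_eq_constantCoeff_apply,
      RingHom.map_det]
    have h1 : constantCoeff.mapMatrix (jacobianMatrix Φ) = 1 := by
      ext p q
      simp [jacobianMatrix, Matrix.one_apply, apply_ite]
    rw [h1, Matrix.det_one]
  set E : Fin m → MvPowerSeries (Fin m) ℂ := fun p => expStar (-((ν p : ℂ) • Φ p)) with hE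
  have hprod : expStar (-weightedSum Φ ν) = ∏ p, E p := by
    rw [weightedSum, ← Finset.sum_neg_distrib, expStar_sum]
  rw [det_jacobianMatrix, hprod, mul_comm, ← Matrix.det_mul_column, coeff_det]
  refine Finset.sum_eq_zero fun l hl => ?_
  have hl' : ∀ q, ∑ p, (l p q : ℂ) = ν q := fun q => by
    have := (Finset.mem_finsuppAntidiag.1 hl).1
    rw [← this, Finsupp.finsetSum_apply]
    simp
  -- When both `ν p` and `l p` vanish, row `p` is a unit vector, not a multiple of the zero row of
  -- `B`. Such rows get weight zero in the linear relation.
  refine det_eq_zero_of_rows (P := fun p => ν p = 0 ∧ l p = 0)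
    (B := Matrix.of fun p q => (if p = q then (ν p : ℂ) else 0) - l p q) ?_ ?_ ?_ ?_
  · by_contra! h
    exact hν (Finsupp.ext fun p => (h p).1)
  · rintro p ⟨h1, h2⟩
    ext q
    simp [h1, h2]
  · intro q
    simp [Finset.sum_sub_distrib, hl']
  · intro p hp
    have key : ∀ q, coeff (l p) (E p * ((if p = q then 1 else 0) +
        MvPowerSeries.X q * pderiv ℂ q (Φ p))) =
        (if p = q then coeff (l p) (E p) else 0) +
          coeff (l p) (MvPowerSeries.X q * (pderiv ℂ q (Φ p) * E p)) := fun q => by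
      rw [mul_add, map_add]
      congr 1
      · split_ifs <;> simp
      · congr 1; ring
    by_cases hp0 : ν p = 0
    · have hlp : l p ≠ 0 := fun h => hp ⟨hp0, h⟩
      have hE1 : E p = 1 := by simp [hE, hp0]
      refine ⟨-coeff (l p) (Φ p), ?_⟩
      ext q
      simp only [Matrix.of_apply, Pi.smul_apply, smul_eq_mul]
      rw [key, hE1, mul_one, coeff_X_mul_pderiv, coeff_one, if_neg hlp, hp0]
      simp [mul_comm]
    · have hν0 : (ν p : ℂ) ≠ 0 := by exact_mod_cast hp0
      refine ⟨coeff (l p) (E p) / ν p, ?_⟩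
      ext q
      simp only [Matrix.of_apply, Pi.smul_apply, smul_eq_mul]
      -- The product is a logarithmic derivative, so both parts of the row involve only the
      -- coefficient of `E p` at `l p`.
      have hd : pderiv ℂ q (Φ p) * E p = -((ν p : ℂ)⁻¹ • pderiv ℂ q (E p)) := by
        rw [hE, pderiv_expStar, map_neg, Derivation.map_smul, neg_mul, smul_neg, neg_neg, smul_mul_assoc,
          smul_smul, inv_mul_cancel₀ hν0, one_smul]
      rw [key, hd, mul_neg, mul_smul_comm, map_neg, coeff_smul, coeff_X_mul_pderiv]
      split_ifs <;> field_simp <;> ring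

/-- The Lagrange–Good formula. -/
theorem coeff_eq_coeff_det_mul_expEndo (H : MvPowerSeries (Fin m) ℂ) (α : Fin m →₀ ℕ) :
    coeff α ((jacobianMatrix Φ).det * expEndo Φ H * expStar (-weightedSum Φ α)) = coeff α H := by
  classical
  let φ : MvPowerSeries (Fin m) ℂ →ₗ[ℂ] ℂ :=
    (coeff α).comp ((LinearMap.mulLeft ℂ ((jacobianMatrix Φ).det * expStar (-weightedSum Φ α))).comp
      (expEndo Φ).toLinearMap)
  have hφ : ∀ f, φ f = coeff α ((jacobianMatrix Φ).det * expEndo Φ f *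
      expStar (-weightedSum Φ α)) := fun f => by
    change coeff α ((jacobianMatrix Φ).det * expStar (-weightedSum Φ α) * expEndo Φ f) = _
    congr 1
    ring
  rw [← hφ, linearMap_apply_eq_sum_monomial φ fun f hf =>
    coeff_mul_eq_zero_of_le (coeff_expEndo_eq_zero Φ hf) _]
  -- With `α = μ + ν`, the exponential produced by the monomial `s^μ` cancels part of `exp(-∑ α_j
  -- Φ_j)`. What remains is the coefficient at `ν` computed above, which is zero unless `ν = 0`.
  have hmon : ∀ μ ∈ Finset.Iic α, coeff μ H * φ (monomial μ 1) =
      if α = μ then coeff μ H else 0 := fun μ hμ => by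
    obtain ⟨ν, rfl⟩ := exists_add_of_le (Finset.mem_Iic.1 hμ)
    have h : (jacobianMatrix Φ).det * expEndo Φ (monomial μ 1) *
        expStar (-weightedSum Φ (μ + ν)) =
        monomial μ 1 * ((jacobianMatrix Φ).det * expStar (-weightedSum Φ ν)) := by
      rw [expEndo_monomial, weightedSum_add, neg_add, expStar_add]
      linear_combination (jacobianMatrix Φ).det * monomial μ 1 * expStar (-weightedSum Φ ν) *
        expStar_mul_neg (weightedSum Φ μ)
    rw [hφ, h, coeff_add_monomial_mul, one_mul, coeff_det_jacobianMatrix_mul_expStar]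
    simp
  rw [Finset.sum_congr rfl hmon, Finset.sum_ite_eq, if_pos (by simp)]

end LagrangeGood

/-! ### The positive cone -/

section Cone

variable {Γ : Type*} [AddCommGroup Γ] {m : ℕ} (b : Module.Basis (Fin m) ℤ Γ)

theorem exponent_cast {γ : Γ} (h : γ ∈ posCone b) (i : Fin m) :
    ((exponent b γ i : ℕ) : ℤ) = b.repr γ i := by
  simpa [exponent] using h i

theorem exponent_injOn : Set.InjOn (exponent b) (posCone b : Set Γ) := by
  intro γ hγ η hη h
  apply b.repr.injective
  ext i
  rw [← exponent_cast b hγ, ← exponent_cast b hη, h]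

theorem exponent_zero : exponent b 0 = 0 := by
  ext i
  simp [exponent]

theorem exponent_ne_zero {γ : Γ} (h : γ ∈ posCone b) (h0 : γ ≠ 0) : exponent b γ ≠ 0 := fun h1 =>
  h0 (exponent_injOn b h (posCone b).zero_mem (h1.trans (exponent_zero b).symm))

theorem exponent_degree {γ : Γ} (h : γ ∈ posCone b) :
    (((exponent b γ).degree : ℕ) : ℤ) = latticeDegree b γ := by
  rw [Finsupp.degree_eq_sum, latticeDegree, Nat.cast_sum]
  exact Finset.sum_congr rfl fun i _ => exponent_cast b h i

theorem eElem_of_mem {γ : Γ} (h : γ ∈ posCone b) :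
    eElem b γ = monomial (exponent b γ) (1 : ℂ) := if_pos h

theorem basis_mem_posCone (i : Fin m) : b i ∈ posCone b := fun j => by
  rw [b.repr_self]
  by_cases h : j = i
  · subst h; simp
  · simp [Finsupp.single_eq_of_ne h]

theorem exponent_basis (i : Fin m) : exponent b (b i) = Finsupp.single i 1 := by
  rw [exponent, b.repr_self, Finsupp.mapRange_single]
  rfl

theorem eElem_basis (i : Fin m) : eElem b (b i) = MvPowerSeries.X i := by
  rw [eElem_of_mem b (basis_mem_posCone b i), exponent_basis, X_def]

/-- The element of the cone with a given exponent vector. -/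
noncomputable def ofExponent (α : Fin m →₀ ℕ) : Γ := ∑ i, α i • b i

theorem ofExponent_mem (α : Fin m →₀ ℕ) : ofExponent b α ∈ posCone b :=
  sum_mem fun i _ => nsmul_mem (basis_mem_posCone b i) _

theorem exponent_ofExponent (α : Fin m →₀ ℕ) : exponent b (ofExponent b α) = α := by
  ext j
  simp only [exponent, ofExponent, Finsupp.mapRange_apply, ← natCast_zsmul]
  rw [b.repr_sum_self]
  simp

theorem ofExponent_exponent {γ : Γ} (h : γ ∈ posCone b) : ofExponent b (exponent b γ) = γ :=
  exponent_injOn b (ofExponent_mem b _) h (exponent_ofExponent b _)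

/-- If `Z γ = 0`, the support property makes the norm of `γ` vanish, so `γ = 0`, which is not
active. -/
theorem StabilityData.Z_ne_zero {m : ℕ} (b : Module.Basis (Fin m) ℤ Γ) (S : StabilityData Γ) {γ : Γ} (h : S.a γ ≠ 0) : S.Z γ ≠ 0 := by
  intro hZ
  obtain ⟨N, hN, K, -, hK⟩ := S.support
  have h1 := hK γ h
  rw [hZ, norm_zero, mul_zero] at h1
  have h2 := hN _ (le_antisymm h1 (apply_nonneg N _))
  apply h
  have h3 : γ = 0 := by
    apply b.repr.injective
    ext i
    have h4 := congrArg (fun x => (Algebra.TensorProduct.basis ℂ b).repr x i) h2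
    simpa using h4
  rw [h3, S.a_zero]

end Cone

/-! ### Integrals along a ray -/

section RayIntegral

/-- Both sides are homogeneous of degree one in `(t, s)`, so it suffices to take the minimum over
the compact segment `t + s = 1`, where the norm never vanishes. -/
theorem exists_le_norm_sub_of_not_aligned {Z Z' : ℂ} (hZ : Z ≠ 0) (hZ' : Z' ≠ 0)
    (h : ∀ t s : ℝ, 0 < t → 0 < s → (t : ℂ) * Z ≠ s * Z') :
    ∃ δ : ℝ, 0 < δ ∧ ∀ t s : ℝ, 0 ≤ t → 0 ≤ s → δ * (t + s) ≤ ‖(t : ℂ) * Z - s * Z'‖ := by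
  have hne : ∀ x ∈ Set.Icc (0 : ℝ) 1, ‖(x : ℂ) * Z - ((1 - x : ℝ) : ℂ) * Z'‖ ≠ 0 := by
    intro x hx h0
    rw [norm_eq_zero, sub_eq_zero] at h0
    rcases hx.1.eq_or_lt with h1 | h1
    · rw [← h1] at h0
      simp [eq_comm, hZ'] at h0
    rcases hx.2.eq_or_lt with h2 | h2
    · rw [h2] at h0
      simp [hZ] at h0
    · exact h _ _ h1 (sub_pos.2 h2) h0
  obtain ⟨x₀, hx₀, hmin⟩ := isCompact_Icc.exists_isMinOn (Set.nonempty_Icc.2 zero_le_one)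
    (f := fun x : ℝ => ‖(x : ℂ) * Z - ((1 - x : ℝ) : ℂ) * Z'‖)
    (Continuous.continuousOn (by fun_prop))
  refine ⟨_, lt_of_le_of_ne (norm_nonneg _) (hne x₀ hx₀).symm, fun t s ht hs => ?_⟩
  rcases (add_nonneg ht hs).eq_or_lt with h0 | h0
  · rw [← h0, mul_zero]; exact norm_nonneg _
  have hx : t / (t + s) ∈ Set.Icc (0 : ℝ) 1 :=
    ⟨by positivity, (div_le_one h0).2 (by linarith)⟩
  have h1 : ((t : ℂ) * Z - s * Z') =
      ((t + s : ℝ) : ℂ) * (((t / (t + s) : ℝ) : ℂ) * Z - ((1 - t / (t + s) : ℝ) : ℂ) * Z') := by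
    have : ((t : ℂ) + s) ≠ 0 := by exact_mod_cast h0.ne'
    push_cast
    field_simp
    ring
  rw [h1, norm_mul, Complex.norm_real, Real.norm_of_nonneg h0.le, mul_comm]
  exact mul_le_mul_of_nonneg_left (hmin hx) h0.le

/-- Numerator and denominator of the kernel are both comparable to `t + s`, which gives a bound
uniform along both rays, including near 0 and ∞. -/
theorem exists_norm_rho_le {Z Z' : ℂ} (hZ : Z ≠ 0) (hZ' : Z' ≠ 0)
    (h : ∀ t s : ℝ, 0 < t → 0 < s → (t : ℂ) * Z ≠ s * Z') :
    ∃ B : ℝ, ∀ t s : ℝ, 0 < t → 0 < s →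
      ‖StabilityData.rho (-(s : ℂ) * Z') (-(t : ℂ) * Z)‖ ≤ B := by
  obtain ⟨δ, hδ, hle⟩ := exists_le_norm_sub_of_not_aligned hZ hZ' h
  refine ⟨‖(1 / (4 * Real.pi * Complex.I) : ℂ)‖ * ((‖Z‖ + ‖Z'‖) / δ), fun t s ht hs => ?_⟩
  rw [StabilityData.rho, norm_mul, norm_div (-(t : ℂ) * Z + -(s : ℂ) * Z')]
  refine mul_le_mul_of_nonneg_left ?_ (norm_nonneg _)
  have h1 : ‖-(t : ℂ) * Z + -(s : ℂ) * Z'‖ ≤ (‖Z‖ + ‖Z'‖) * (t + s) := by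
    refine (norm_add_le _ _).trans ?_
    simp only [norm_mul, norm_neg, Complex.norm_real, Real.norm_of_nonneg ht.le,
      Real.norm_of_nonneg hs.le]
    nlinarith [norm_nonneg Z, norm_nonneg Z']
  have h2 : δ * (t + s) ≤ ‖-(t : ℂ) * Z - -(s : ℂ) * Z'‖ := by
    rw [← norm_neg, show -(-(t : ℂ) * Z - -(s : ℂ) * Z') = t * Z - s * Z' by ring]
    exact hle t s ht.le hs.le
  have hpos : 0 < δ * (t + s) := by positivity
  calc _ ≤ (‖Z‖ + ‖Z'‖) * (t + s) / (δ * (t + s)) := div_le_div₀ (by positivity) h1 hpos h2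
    _ = _ := by field_simp

theorem measurable_rho (Z z : ℂ) :
    Measurable fun t : ℝ => StabilityData.rho z (-(t : ℂ) * Z) := by
  unfold StabilityData.rho
  fun_prop

theorem exists_eq_neg_mul_of_notMem_ray {Z z : ℂ} (hz : ∀ t : ℝ, 0 < t → z ≠ -(t : ℂ) * Z) :
    ∀ t s : ℝ, 0 < t → 0 < s → (t : ℂ) * Z ≠ s * -z := by
  intro t s ht hs heq
  apply hz (t / s) (by positivity)
  have : (s : ℂ) ≠ 0 := by exact_mod_cast hs.ne'
  push_cast
  field_simp
  linear_combination heq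

theorem integrableOn_rho_mul {Z z : ℂ} {φ : ℝ → ℂ} (hφ : IntegrableOn φ (Set.Ioi 0))
    (hZ : Z ≠ 0) (hz0 : z ≠ 0) (hz : ∀ t : ℝ, 0 < t → z ≠ -(t : ℂ) * Z) :
    IntegrableOn (fun t : ℝ => StabilityData.rho z (-(t : ℂ) * Z) * φ t) (Set.Ioi 0) := by
  obtain ⟨B, hB⟩ := exists_norm_rho_le hZ (neg_ne_zero.2 hz0) (exists_eq_neg_mul_of_notMem_ray hz)
  refine hφ.bdd_mul (c := B) (measurable_rho Z z).aestronglyMeasurable ?_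
  filter_upwards [ae_restrict_mem measurableSet_Ioi] with t ht
  simpa using hB t 1 ht one_pos

theorem exists_norm_integral_rho_mul_le {Z Z' : ℂ} {φ : ℝ → ℂ} (hφ : IntegrableOn φ (Set.Ioi 0))
    (hZ : Z ≠ 0) (hZ' : Z' ≠ 0) (h : ∀ t s : ℝ, 0 < t → 0 < s → (t : ℂ) * Z ≠ s * Z') :
    ∃ B : ℝ, ∀ s : ℝ, 0 < s →
      ‖∫ t in Set.Ioi (0 : ℝ), StabilityData.rho (-(s : ℂ) * Z') (-(t : ℂ) * Z) * φ t‖ ≤ B := by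
  obtain ⟨B, hB⟩ := exists_norm_rho_le hZ hZ' h
  refine ⟨∫ t in Set.Ioi (0 : ℝ), B * ‖φ t‖, fun s hs => ?_⟩
  refine norm_integral_le_of_norm_le (hφ.norm.const_mul B) ?_
  filter_upwards [ae_restrict_mem measurableSet_Ioi] with t ht
  rw [norm_mul]
  exact mul_le_mul_of_nonneg_right (hB t s ht hs) (norm_nonneg _)

theorem differentiableAt_integral_rho_mul {Z z : ℂ} {φ : ℝ → ℂ}
    (hφ : IntegrableOn φ (Set.Ioi 0)) (hZ : Z ≠ 0) (hz0 : z ≠ 0)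
    (hz : ∀ t : ℝ, 0 < t → z ≠ -(t : ℂ) * Z) :
    DifferentiableAt ℂ
      (fun w => ∫ t in Set.Ioi (0 : ℝ), StabilityData.rho w (-(t : ℂ) * Z) * φ t) z := by
  obtain ⟨δ, hδ, hle⟩ := exists_le_norm_sub_of_not_aligned hZ (neg_ne_zero.2 hz0)
    (exists_eq_neg_mul_of_notMem_ray hz)
  -- Moving `z` by less than `δ / 2` costs at most half of the lower bound `δ (t + 1)`, since `t + 1
  -- ≥ 1`. This makes the domination uniform near `z`.
  have hlow : ∀ w ∈ Metric.ball z (δ / 2), ∀ t : ℝ, 0 < t →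
      δ / 2 * (t + 1) ≤ ‖-(t : ℂ) * Z - w‖ := by
    intro w hw t ht
    have h1 : δ * (t + 1) ≤ ‖-(t : ℂ) * Z - z‖ := by
      rw [← norm_neg, show -(-(t : ℂ) * Z - z) = t * Z - (1 : ℝ) * -z by push_cast; ring]
      exact hle t 1 ht.le zero_le_one
    have h2 : ‖w - z‖ < δ / 2 := by simpa [dist_eq_norm] using hw
    have h3 : ‖-(t : ℂ) * Z - z‖ ≤ ‖-(t : ℂ) * Z - w‖ + ‖w - z‖ := by
      refine le_trans (le_of_eq ?_) (norm_add_le _ _)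
      congr 1
      ring
    nlinarith
  set c : ℂ := 1 / (4 * Real.pi * Complex.I) with hc
  refine (hasDerivAt_integral_of_dominated_loc_of_deriv_le (𝕜 := ℂ)
    (F := fun w t => StabilityData.rho w (-(t : ℂ) * Z) * φ t)
    (F' := fun w t => c * ((-2 * t * Z) / (-(t : ℂ) * Z - w) ^ 2) * φ t)
    (bound := fun t => ‖c‖ * (2 * ‖Z‖ / (δ / 2) ^ 2) * ‖φ t‖)
    (Metric.ball_mem_nhds z (half_pos hδ)) ?_ (integrableOn_rho_mul hφ hZ hz0 hz) ?_ ?_ ?_ ?_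
    ).2.differentiableAt
  · exact Filter.Eventually.of_forall fun w =>
      (measurable_rho Z w).aestronglyMeasurable.mul hφ.aestronglyMeasurable
  · refine AEStronglyMeasurable.mul (Measurable.aestronglyMeasurable ?_) hφ.aestronglyMeasurable
    fun_prop
  · filter_upwards [ae_restrict_mem measurableSet_Ioi] with t ht w hw
    rw [norm_mul, norm_mul]
    refine mul_le_mul_of_nonneg_right (mul_le_mul_of_nonneg_left ?_ (norm_nonneg _))
      (norm_nonneg _)
    have ht' : (0 : ℝ) < t := ht
    rw [norm_div, norm_pow]
    have h1 : ‖(-2 * t * Z : ℂ)‖ ≤ 2 * ‖Z‖ * (t + 1) ^ 2 := by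
      simp only [norm_mul, norm_neg, Complex.norm_real, Real.norm_of_nonneg ht'.le,
        Complex.norm_ofNat]
      nlinarith [norm_nonneg Z, mul_nonneg (norm_nonneg Z) (by positivity : 0 ≤ t ^ 2 + t + 1)]
    have h2 : (δ / 2) ^ 2 * (t + 1) ^ 2 ≤ ‖-(t : ℂ) * Z - w‖ ^ 2 := by
      rw [← mul_pow]
      exact pow_le_pow_left₀ (by positivity) (hlow w hw t ht) 2
    calc _ ≤ (2 * ‖Z‖ * (t + 1) ^ 2) / ((δ / 2) ^ 2 * (t + 1) ^ 2) :=
          div_le_div₀ (by positivity) h1 (by positivity) h2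
      _ = _ := by field_simp
  · exact hφ.norm.const_mul _
  · filter_upwards [ae_restrict_mem measurableSet_Ioi] with t ht w hw
    have ht' : (0 : ℝ) < t := ht
    have hne : -(t : ℂ) * Z - w ≠ 0 := fun h0 => by
      have := hlow w hw t ht'
      rw [h0, norm_zero] at this
      nlinarith
    have h1 : HasDerivAt (fun w : ℂ => (-(t : ℂ) * Z + w) / (-(t : ℂ) * Z - w))
        ((1 * (-(t : ℂ) * Z - w) - (-(t : ℂ) * Z + w) * (-1)) / (-(t : ℂ) * Z - w) ^ 2) w :=
      ((hasDerivAt_id w).const_add _).div ((hasDerivAt_id w).const_sub _) hne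
    refine ((h1.const_mul c).mul_const (φ t)).congr_deriv ?_
    ring

/-- The kernel `exp (L(z')) dz'/z'` is integrable along the ray. -/
theorem integrableOn_inv_mul_exp_mul {Z : ℂ} (hZ : Z ≠ 0) {H : ℝ → ℂ}
    (hH : ContinuousOn H (Set.Ioi 0)) {B : ℝ} (hB : ∀ t, 0 < t → ‖H t‖ ≤ B) :
    IntegrableOn (fun t : ℝ => (t : ℂ)⁻¹ * (Complex.exp (Z / (-(t : ℂ) * Z) +
      -(t : ℂ) * Z * (starRingEnd ℂ) Z) * H t)) (Set.Ioi 0) := by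
  have hc : 0 < Complex.normSq Z := Complex.normSq_pos.2 hZ
  refine Integrable.mono' ((exp_neg_integrableOn_Ioi 0 hc).const_mul B) ?_ ?_
  · rw [show (fun t : ℝ => (t : ℂ)⁻¹ * (Complex.exp (Z / (-(t : ℂ) * Z) +
      -(t : ℂ) * Z * (starRingEnd ℂ) Z) * H t)) = fun t : ℝ => ((t : ℂ)⁻¹ *
      Complex.exp (Z / (-(t : ℂ) * Z) + -(t : ℂ) * Z * (starRingEnd ℂ) Z)) * H t from by
      ext t; ring]
    refine AEStronglyMeasurable.mul (Measurable.aestronglyMeasurable ?_)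
      (hH.aestronglyMeasurable measurableSet_Ioi)
    fun_prop
  · filter_upwards [ae_restrict_mem measurableSet_Ioi] with t ht
    have ht' : (0 : ℝ) < t := ht
    have htc : (t : ℂ) ≠ 0 := by exact_mod_cast ht'.ne'
    -- On the ray `L` is real, equal to `-1/t - |Z|² t`.
    have h1 : Z / (-(t : ℂ) * Z) + -(t : ℂ) * Z * (starRingEnd ℂ) Z =
        ((-t⁻¹ + -Complex.normSq Z * t : ℝ) : ℂ) := by
      rw [mul_assoc, Complex.mul_conj]
      push_cast
      field_simp
    rw [h1, norm_mul, norm_mul, Complex.norm_exp_ofReal, norm_inv, Complex.norm_real,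
      Real.norm_of_nonneg ht'.le, Real.exp_add]
    -- The term `-1/t` absorbs the pole of `dt/t` at 0; the other term gives integrability at
    -- infinity.
    have h2 : t⁻¹ * Real.exp (-t⁻¹) ≤ 1 := by
      rw [Real.exp_neg, ← div_eq_mul_inv, div_le_one (Real.exp_pos _)]
      linarith [Real.add_one_le_exp t⁻¹]
    calc t⁻¹ * (Real.exp (-t⁻¹) * Real.exp (-Complex.normSq Z * t) * ‖H t‖)
        = (t⁻¹ * Real.exp (-t⁻¹)) * (‖H t‖ * Real.exp (-Complex.normSq Z * t)) := by ring
      _ ≤ 1 * (B * Real.exp (-Complex.normSq Z * t)) := by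
        gcongr
        exact hB t ht'
      _ = _ := one_mul _

end RayIntegral

/-! ### Trees with active labels -/

/-- The sum of the exponent vectors of the labels. -/
noncomputable def OrderedTree.totalExponent {Γ : Type*} [AddCommGroup Γ] {m : ℕ}
    (b : Module.Basis (Fin m) ℤ Γ) : OrderedTree Γ → (Fin m →₀ ℕ)
  | node γ _ c => exponent b γ + ∑ i, totalExponent b (c i)

namespace StabilityData

open OrderedTree

variable {Γ : Type*} [AddCommGroup Γ] {m : ℕ}
  (S : StabilityData Γ) (b : Module.Basis (Fin m) ℤ Γ) (form : Γ →ₗ[ℤ] Γ →ₗ[ℤ] ℤ)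

/-- All labels are active, and adjacent labels have a non-zero pairing. -/
def IsAdmissible : OrderedTree Γ → Prop
  | node γ _ c => S.a γ ≠ 0 ∧ ∀ i, form γ (rootLabel (c i)) ≠ 0 ∧ IsAdmissible (c i)

variable {S b form}

theorem IsAdmissible.a_ne_zero : ∀ {T : OrderedTree Γ}, S.IsAdmissible form T →
    S.a T.rootLabel ≠ 0
  | node _ _ _, h => h.1

theorem isAdmissible_of_edgeProd_ne_zero : ∀ T : OrderedTree Γ, S.a T.rootLabel ≠ 0 →
    T.edgeProd (fun v w => (form v w : ℚ) * S.DT w) ≠ 0 → S.IsAdmissible form T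
  | node γ n c, ha, hE => by
    refine ⟨ha, fun i => ?_⟩
    rw [edgeProd, Finset.prod_ne_zero_iff] at hE
    have h1 := mul_ne_zero_iff.1 (hE i (Finset.mem_univ _))
    have h2 := mul_ne_zero_iff.1 h1.1
    refine ⟨by exact_mod_cast h2.1, isAdmissible_of_edgeProd_ne_zero (c i) ?_ h1.2⟩
    simpa [DT] using h2.2

theorem isAdmissible_of_W_ne_zero {T : DecTree Γ} (h : S.W form T ≠ 0) :
    S.IsAdmissible form T.rep := by
  have h1 : ((-1) ^ T.rep.numEdges * S.DT T.rep.rootLabel / T.rep.autCard *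
      T.rep.edgeProd (fun v w => (form v w : ℚ) * S.DT w) : ℚ) ≠ 0 := fun h0 =>
    h (by rw [W, h0, TensorProduct.tmul_zero])
  have h2 := mul_ne_zero_iff.1 h1
  refine isAdmissible_of_edgeProd_ne_zero _ (fun h0 => h2.1 ?_) h2.2
  simp [DT, h0]

theorem exponent_ne_zero_of_a_ne_zero (hpos : S.IsPositive b) {γ : Γ} (h : S.a γ ≠ 0) :
    exponent b γ ≠ 0 :=
  exponent_ne_zero b (hpos γ h) fun h0 => h (by rw [h0, S.a_zero])

theorem exponent_rootLabel_le : ∀ T : OrderedTree Γ,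
    exponent b T.rootLabel ≤ T.totalExponent b
  | node _ _ _ => le_self_add

theorem totalExponent_ne_zero (hpos : S.IsPositive b) {T : OrderedTree Γ}
    (h : S.IsAdmissible form T) : T.totalExponent b ≠ 0 := fun h0 =>
  exponent_ne_zero_of_a_ne_zero hpos h.a_ne_zero
    (le_antisymm ((exponent_rootLabel_le T).trans h0.le) zero_le)

/-- Active labels have nonzero exponents. Hence the root label and the number of children are
bounded in terms of `β`, and the subtrees have strictly smaller total exponent. -/
theorem finite_isAdmissible (hpos : S.IsPositive b) (β : Fin m →₀ ℕ) :
    {T : OrderedTree Γ | S.IsAdmissible form T ∧ T.totalExponent b = β}.Finite := by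
  induction β using WellFoundedLT.induction with
  | ind β ih =>
    let A : Set Γ := {γ | γ ∈ posCone b ∧ exponent b γ ≤ β}
    have hA : A.Finite := by
      refine Set.Finite.of_finite_image ((Set.finite_Iic β).subset ?_)
        ((exponent_injOn b).mono fun γ hγ => hγ.1)
      rintro _ ⟨γ, hγ, rfl⟩
      exact hγ.2
    let F : Set (OrderedTree Γ) := ⋃ β' ∈ Set.Iio β,
      {T : OrderedTree Γ | S.IsAdmissible form T ∧ T.totalExponent b = β'}
    have hF : F.Finite := (Set.finite_Iio β).biUnion fun β' hβ' => ih β' hβ'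
    have hfin : (⋃ γ ∈ A, ⋃ n ∈ Set.Iic β.degree,
        (fun c : Fin n → OrderedTree Γ => node γ n c) '' (Set.univ.pi fun _ => F)).Finite :=
      hA.biUnion fun γ _ => (Set.finite_Iic _).biUnion fun n _ =>
        (Set.Finite.pi fun _ => hF).image _
    refine hfin.subset ?_
    rintro ⟨γ, n, c⟩ ⟨h, hβ⟩
    have hroot := exponent_ne_zero_of_a_ne_zero hpos h.1
    rw [totalExponent] at hβ
    have hsum : ∑ i, (c i).totalExponent b < β := by
      rw [← hβ]
      exact lt_add_of_pos_left _ (pos_iff_ne_zero.2 hroot)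
    simp only [Set.mem_iUnion]
    refine ⟨γ, ⟨hpos γ h.1, ?_⟩, n, ?_, c, ?_, rfl⟩
    · rw [← hβ]; exact le_self_add
    · have h1 : (β.degree : ℕ) = (exponent b γ).degree + ∑ i, ((c i).totalExponent b).degree := by
        rw [← hβ, map_add, map_sum]
      have h2 : ∑ _i : Fin n, 1 ≤ ∑ i, ((c i).totalExponent b).degree :=
        Finset.sum_le_sum fun i _ => by
          rw [Nat.one_le_iff_ne_zero, Ne, Finsupp.degree_eq_zero_iff]
          exact totalExponent_ne_zero hpos (h.2 i).2
      simp only [Finset.sum_const, Finset.card_univ, Fintype.card_fin, smul_eq_mul, mul_one] at h2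
      exact Set.mem_Iic.2 (by omega)
    · intro i _
      simp only [F, Set.mem_iUnion]
      exact ⟨_, (Finset.single_le_sum (f := fun i => (c i).totalExponent b)
        (fun _ _ => zero_le) (Finset.mem_univ i)).trans_lt hsum, (h.2 i).2, rfl⟩

/-! ### The propagators -/

theorem coeff_propagator_eq_integral : ∀ (T : OrderedTree Γ) (z : ℂ) (β : Fin m →₀ ℕ),
    coeff β (S.propagator b T z) = ∫ t in Set.Ioi (0 : ℝ), S.propagatorIntegrand b T β z t
  | node γ n c, z, β => by
    rw [coeff_apply, propagator]
    rfl

/-- This holds for every `z`, even on the root ray: in any other coefficient the integrand itself is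
zero, so convergence plays no role. -/
theorem propagator_eq_monomial (hpos : S.IsPositive b) : ∀ T : OrderedTree Γ,
    S.IsAdmissible form T → ∀ z : ℂ, S.propagator b T z =
      monomial (T.totalExponent b) (coeff (T.totalExponent b) (S.propagator b T z))
  | node γ n c, h, z => by
    classical
    ext β
    rw [coeff_monomial]
    split_ifs with hβ
    · rw [hβ]
    · rw [totalExponent] at hβ
      rw [coeff_propagator_eq_integral]
      refine (setIntegral_congr_fun measurableSet_Ioi fun t _ => ?_).trans
        (integral_zero ℝ ℂ)
      rw [propagatorIntegrand, rayIntegrand, X0, eElem_of_mem b (hpos γ h.1),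
        Finset.prod_congr rfl fun i _ => propagator_eq_monomial hpos (c i) (h.2 i).2 _,
        MvPowerSeries.prod_monomial, mul_assoc (C _), monomial_mul_monomial, coeff_C_mul,
        coeff_monomial_ne hβ, mul_zero, mul_zero]

/-- The coefficient of the only monomial in `G_T(z)`. -/
noncomputable def propagatorCoeff (S : StabilityData Γ) (b : Module.Basis (Fin m) ℤ Γ)
    (T : OrderedTree Γ) (z : ℂ) : ℂ :=
  coeff (T.totalExponent b) (S.propagator b T z)

theorem coeff_propagator (hpos : S.IsPositive b) {T : OrderedTree Γ}
    (h : S.IsAdmissible form T) (z : ℂ) (β : Fin m →₀ ℕ) [Decidable (β = T.totalExponent b)] :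
    coeff β (S.propagator b T z) =
      if β = T.totalExponent b then S.propagatorCoeff b T z else 0 := by
  classical
  rw [propagator_eq_monomial hpos T h z, coeff_monomial]
  split_ifs <;> rfl

/-- The part of the integrand of `G_T` which does not depend on the external variable. -/
noncomputable def rayWeight (S : StabilityData Γ) (γ : Γ) (H : ℂ → ℂ) (t : ℝ) : ℂ :=
  (t : ℂ)⁻¹ * (Complex.exp (S.Z γ / (-(t : ℂ) * S.Z γ) +
    -(t : ℂ) * S.Z γ * (starRingEnd ℂ) (S.Z γ)) * H (-(t : ℂ) * S.Z γ))

theorem propagatorIntegrand_node (hpos : S.IsPositive b) {γ : Γ} {n : ℕ}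
    {c : Fin n → OrderedTree Γ} (h : S.IsAdmissible form (node γ n c)) (β : Fin m →₀ ℕ)
    (z : ℂ) (t : ℝ) [Decidable (β = (node γ n c).totalExponent b)] :
    S.propagatorIntegrand b (node γ n c) β z t =
      if β = (node γ n c).totalExponent b then
        rho z (-(t : ℂ) * S.Z γ) *
          S.rayWeight γ (fun w => ∏ i, S.propagatorCoeff b (c i) w) t else 0 := by
  classical
  rw [propagatorIntegrand, rayIntegrand, X0, eElem_of_mem b (hpos γ h.1),
    Finset.prod_congr rfl fun i _ => propagator_eq_monomial hpos (c i) (h.2 i).2 _,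
    MvPowerSeries.prod_monomial, mul_assoc (C _), monomial_mul_monomial, coeff_C_mul,
    coeff_monomial, rayWeight, L]
  rw [← totalExponent.eq_1 b γ n c]
  split_ifs
  · simp only [propagatorCoeff]
    ring
  · simp

theorem propagatorCoeff_node (hpos : S.IsPositive b) {γ : Γ} {n : ℕ}
    {c : Fin n → OrderedTree Γ} (h : S.IsAdmissible form (node γ n c)) (z : ℂ) :
    S.propagatorCoeff b (node γ n c) z = ∫ t in Set.Ioi (0 : ℝ),
      rho z (-(t : ℂ) * S.Z γ) *
        S.rayWeight γ (fun w => ∏ i, S.propagatorCoeff b (c i) w) t := by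
  classical
  rw [propagatorCoeff, coeff_propagator_eq_integral]
  simp only [propagatorIntegrand_node hpos h, if_true]

theorem ray_eq_of_mul_eq {γ η : Γ} {t s : ℝ} (ht : 0 < t) (hs : 0 < s)
    (h : (t : ℂ) * S.Z γ = s * S.Z η) : S.ray γ = S.ray η := by
  have htc : (t : ℂ) ≠ 0 := by exact_mod_cast ht.ne'
  have hsc : (s : ℂ) ≠ 0 := by exact_mod_cast hs.ne'
  ext w
  constructor
  · rintro ⟨r, hr, rfl⟩
    refine ⟨r * s / t, by positivity, ?_⟩
    push_cast
    field_simp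
    linear_combination -r * h
  · rintro ⟨r, hr, rfl⟩
    refine ⟨r * t / s, by positivity, ?_⟩
    push_cast
    field_simp
    linear_combination r * h

theorem ne_neg_mul_of_notMem_ray {γ : Γ} {z : ℂ} (hz : z ∉ S.ray γ) :
    ∀ t : ℝ, 0 < t → z ≠ -(t : ℂ) * S.Z γ := fun t ht h => hz ⟨t, ht, h⟩

/-- The analytic properties of the propagator of a tree. -/
structure IsRegular (S : StabilityData Γ) (b : Module.Basis (Fin m) ℤ Γ)
    (T : OrderedTree Γ) : Prop where
  differentiableAt : ∀ z : ℂ, z ≠ 0 → z ∉ S.ray T.rootLabel →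
    DifferentiableAt ℂ (S.propagatorCoeff b T) z
  bounded : ∀ Z' : ℂ, Z' ≠ 0 →
    (∀ t s : ℝ, 0 < t → 0 < s → (t : ℂ) * S.Z T.rootLabel ≠ s * Z') →
    ∃ B : ℝ, ∀ s : ℝ, 0 < s → ‖S.propagatorCoeff b T (-(s : ℂ) * Z')‖ ≤ B

theorem not_aligned_of_form_ne_zero (hgen : S.IsGeneric form) {γ η : Γ} (hγ : S.a γ ≠ 0)
    (hη : S.a η ≠ 0) (h : form γ η ≠ 0) (t s : ℝ) (ht : 0 < t) (hs : 0 < s) :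
    (t : ℂ) * S.Z η ≠ s * S.Z γ := fun h0 =>
  h (hgen γ η hγ hη (ray_eq_of_mul_eq ht hs h0).symm)

/-- Genericity enters here: each child's ray differs from the parent's, so along the parent's ray
the child propagators are continuous and bounded. -/
theorem integrableOn_rayWeight (b : Module.Basis (Fin m) ℤ Γ) (hgen : S.IsGeneric form)
    {γ : Γ} {n : ℕ} {c : Fin n → OrderedTree Γ} (h : S.IsAdmissible form (node γ n c))
    (hreg : ∀ i, S.IsRegular b (c i)) :
    IntegrableOn (S.rayWeight γ fun w => ∏ i, S.propagatorCoeff b (c i) w) (Set.Ioi 0) := by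
  have hZ := S.Z_ne_zero b h.1
  have hal := fun i => not_aligned_of_form_ne_zero hgen h.1 (h.2 i).2.a_ne_zero (h.2 i).1
  choose B hB using fun i => (hreg i).bounded _ hZ (hal i)
  refine integrableOn_inv_mul_exp_mul hZ
    (H := fun t => ∏ i, S.propagatorCoeff b (c i) (-(t : ℂ) * S.Z γ)) ?_ (B := ∏ i, B i) ?_
  · refine continuousOn_finsetProd _ fun i _ t ht => ContinuousAt.continuousWithinAt ?_
    have ht' : (0 : ℝ) < t := ht
    refine ContinuousAt.comp (f := fun t : ℝ => -(t : ℂ) * S.Z γ)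
      ((hreg i).differentiableAt _ ?_ ?_).continuousAt (by fun_prop)
    · exact mul_ne_zero (neg_ne_zero.2 (by exact_mod_cast ht'.ne')) hZ
    · rintro ⟨r, hr, hrt⟩
      exact hal i r t hr ht' (by linear_combination hrt)
  · intro t ht
    rw [norm_prod]
    exact Finset.prod_le_prod (fun _ _ => norm_nonneg _) fun i _ => hB i t ht

theorem IsAdmissible.isRegular (hpos : S.IsPositive b) (hgen : S.IsGeneric form) :
    ∀ T : OrderedTree Γ, S.IsAdmissible form T → S.IsRegular b T
  | node γ n c, h => by
    have hZ := S.Z_ne_zero b h.1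
    have hφ := integrableOn_rayWeight b hgen h fun i =>
      IsAdmissible.isRegular hpos hgen (c i) (h.2 i).2
    have hF := funext (propagatorCoeff_node hpos h)
    constructor
    · intro z hz0 hz
      rw [hF]
      exact differentiableAt_integral_rho_mul hφ hZ hz0 (ne_neg_mul_of_notMem_ray hz)
    · intro Z' hZ' hal
      rw [hF]
      exact exists_norm_integral_rho_mul_le hφ hZ hZ' hal

theorem IsAdmissible.integrableOn_propagatorIntegrand (hpos : S.IsPositive b)
    (hgen : S.IsGeneric form) : ∀ T : OrderedTree Γ, S.IsAdmissible form T → ∀ z : ℂ, z ≠ 0 →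
    z ∉ S.ray T.rootLabel → ∀ β, IntegrableOn (S.propagatorIntegrand b T β z) (Set.Ioi 0)
  | node γ n c, h, z, hz0, hz, β => by
    classical
    have hφ := integrableOn_rayWeight b hgen h fun i =>
      IsAdmissible.isRegular hpos hgen (c i) (h.2 i).2
    rw [show S.propagatorIntegrand b (node γ n c) β z = _ from
      funext fun t => propagatorIntegrand_node hpos h β z t]
    split_ifs
    · exact integrableOn_rho_mul hφ (S.Z_ne_zero b h.1) hz0 (ne_neg_mul_of_notMem_ray hz)
    · exact integrableOn_zero

theorem differentiableAt_coeff_propagator (hpos : S.IsPositive b) (hgen : S.IsGeneric form)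
    {T : OrderedTree Γ} (h : S.IsAdmissible form T) {z : ℂ} (hz0 : z ≠ 0)
    (hz : z ∉ S.ray T.rootLabel) (β : Fin m →₀ ℕ) :
    DifferentiableAt ℂ (fun w => coeff β (S.propagator b T w)) z := by
  classical
  simp only [coeff_propagator hpos h]
  split_ifs
  · exact (h.isRegular hpos hgen).differentiableAt z hz0 hz
  · exact differentiableAt_const _

theorem finite_support_G (hpos : S.IsPositive b) (β : Fin m →₀ ℕ) :
    {T : DecTree Γ | S.W form T ≠ 0 ∧ ∃ z, coeff β (S.G b T z) ≠ 0}.Finite := by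
  classical
  refine Set.Finite.of_finite_image (f := DecTree.rep) ((finite_isAdmissible (form := form)
    hpos β).subset ?_) (Quotient.out_injective.injOn)
  rintro _ ⟨T, ⟨hW, z, hz⟩, rfl⟩
  have hadm := isAdmissible_of_W_ne_zero hW
  refine ⟨hadm, ?_⟩
  by_contra hne
  rw [G, coeff_propagator hpos hadm, if_neg (Ne.symm hne)] at hz
  exact hz rfl

end StabilityData

/-! ### Coefficientwise derivatives -/

section CoeffDeriv

variable {m : ℕ}

/-- The coefficients of degree `≤ k` of `F` are differentiable at `z`, with derivative given by
those of `F'`. -/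
def HasCoeffDerivAt (k : ℕ) (F : ℂ → MvPowerSeries (Fin m) ℂ) (F' : MvPowerSeries (Fin m) ℂ)
    (z : ℂ) : Prop :=
  ∀ β : Fin m →₀ ℕ, β.degree ≤ k → HasDerivAt (fun w => coeff β (F w)) (coeff β F') z

variable {k : ℕ} {F G : ℂ → MvPowerSeries (Fin m) ℂ} {F' G' : MvPowerSeries (Fin m) ℂ} {z : ℂ}

theorem HasCoeffDerivAt.add (hF : HasCoeffDerivAt k F F' z) (hG : HasCoeffDerivAt k G G' z) :
    HasCoeffDerivAt k (fun w => F w + G w) (F' + G') z := fun β hβ => by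
  simpa only [map_add] using (hF β hβ).fun_add (hG β hβ)

theorem HasCoeffDerivAt.sub (hF : HasCoeffDerivAt k F F' z) (hG : HasCoeffDerivAt k G G' z) :
    HasCoeffDerivAt k (fun w => F w - G w) (F' - G') z := fun β hβ => by
  simpa only [map_sub] using (hF β hβ).fun_sub (hG β hβ)

theorem HasCoeffDerivAt.sum {ι : Type*} {s : Finset ι} {F : ι → ℂ → MvPowerSeries (Fin m) ℂ}
    {F' : ι → MvPowerSeries (Fin m) ℂ} (h : ∀ i ∈ s, HasCoeffDerivAt k (F i) (F' i) z) :
    HasCoeffDerivAt k (fun w => ∑ i ∈ s, F i w) (∑ i ∈ s, F' i) z := fun β hβ => by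
  simpa only [map_sum] using HasDerivAt.fun_sum fun i hi => h i hi β hβ

theorem hasCoeffDerivAt_const (f : MvPowerSeries (Fin m) ℂ) :
    HasCoeffDerivAt k (fun _ => f) 0 z := fun β _ => by
  simpa using hasDerivAt_const z (coeff β f)

theorem hasCoeffDerivAt_C {c : ℂ → ℂ} {c' : ℂ} (h : HasDerivAt c c' z) :
    HasCoeffDerivAt (m := m) k (fun w => C (c w)) (C c') z := fun β _ => by
  classical
  simp only [coeff_C]
  split_ifs
  · exact h
  · exact hasDerivAt_const z 0

theorem HasCoeffDerivAt.mul (hF : HasCoeffDerivAt k F F' z) (hG : HasCoeffDerivAt k G G' z) :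
    HasCoeffDerivAt k (fun w => F w * G w) (F' * G z + F z * G') z := fun β hβ => by
  classical
  simp only [map_add, coeff_mul, ← Finset.sum_add_distrib]
  refine HasDerivAt.fun_sum fun x hx => ?_
  have := congrArg Finsupp.degree (Finset.HasAntidiagonal.mem_antidiagonal.1 hx)
  simp only [map_add] at this
  exact (hF _ (by omega)).mul (hG _ (by omega))

theorem HasCoeffDerivAt.pow (hF : HasCoeffDerivAt k F F' z) (n : ℕ) :
    HasCoeffDerivAt k (fun w => F w ^ n) (n * F z ^ (n - 1) * F') z := by
  induction n with
  | zero => simpa using hasCoeffDerivAt_const (k := k) (z := z) (1 : MvPowerSeries (Fin m) ℂ)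
  | succ n ih =>
    simp only [pow_succ]
    convert ih.mul hF using 1
    rcases n with _ | n
    · simp
    · simp only [add_tsub_cancel_right, pow_succ]
      push_cast
      ring

theorem HasCoeffDerivAt.expTrunc (hF : HasCoeffDerivAt k F F' z) (N : ℕ) :
    HasCoeffDerivAt k (fun w => expTrunc (N + 1) (F w)) (F' * _root_.expTrunc N (F z)) z := by
  rw [← sum_inv_factorial_mul_pow_pred]
  refine HasCoeffDerivAt.sum fun n _ => ?_
  simpa using (hasCoeffDerivAt_const (C ((n.factorial : ℂ)⁻¹))).mul (hF.pow n)

/-- Differentiating a truncated exponential lowers its order by one, so truncating at `k + 2` leaves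
order `k + 1`, still exact in degrees up to `k`. -/
theorem HasCoeffDerivAt.expStar (hF : HasCoeffDerivAt k F F' z) :
    HasCoeffDerivAt k (fun w => expStar (F w)) (F' * _root_.expStar (F z)) z := fun β hβ => by
  have h0 : HasDerivAt (fun w => constantCoeff (F w)) (constantCoeff F') z := by
    simpa only [coeff_zero_eq_constantCoeff_apply] using hF 0 (by simp)
  have hsub := hF.sub (hasCoeffDerivAt_C h0)
  have h := ((hasCoeffDerivAt_C h0.cexp).mul (hsub.expTrunc (k + 1))) β hβ
  simp only [coeff_expStar _ (show β.degree < k + 1 + 1 by omega)]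
  refine h.congr_deriv ?_
  have h1 : coeff β (F' * _root_.expStar (F z)) =
      coeff β (C (constantCoeff F') * _root_.expStar (F z)) +
        coeff β ((F' - C (constantCoeff F')) * _root_.expStar (F z)) := by
    rw [← map_add]
    congr 1
    ring
  rw [h1, coeff_mul_congr_of_degree_le (fun γ hγ => coeff_expStar (F z)
      (show γ.degree < k + 1 + 1 by omega)) hβ,
    coeff_mul_congr_of_degree_le (P := F' - C (constantCoeff F')) (fun γ hγ => coeff_expStar (F z)
      (show γ.degree < k + 1 by omega)) hβ, ← map_add, map_mul]
  congr 1
  ring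

theorem HasCoeffDerivAt.congr_coeff (hF : HasCoeffDerivAt k F F' z)
    (hG : HasCoeffDerivAt k F G' z) {β : Fin m →₀ ℕ} (hβ : β.degree ≤ k) :
    coeff β F' = coeff β G' :=
  (hF β hβ).unique (hG β hβ)

end CoeffDeriv

namespace StabilityData

variable {Γ : Type*} [AddCommGroup Γ] {m : ℕ}
  {S : StabilityData Γ} {b : Module.Basis (Fin m) ℤ Γ} {form : Γ →ₗ[ℤ] Γ →ₗ[ℤ] ℤ}

/-! ### The flat section on monomials -/

theorem pairQ_add (α α' : Γ) (x : Γ ⊗[ℤ] ℚ) :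
    pairQ form (α + α') x = pairQ form α x + pairQ form α' x := by
  simp [pairQ, LinearMap.rTensor_add]

theorem pairQ_zero (α : Γ) : pairQ form α 0 = 0 := by simp [pairQ]

theorem zero_pairQ (x : Γ ⊗[ℤ] ℚ) : pairQ form 0 x = 0 := by simp [pairQ]

/-- The trees contributing to the coefficient of `s^β`. -/
noncomputable def contributingTrees (form : Γ →ₗ[ℤ] Γ →ₗ[ℤ] ℤ) (hpos : S.IsPositive b)
    (β : Fin m →₀ ℕ) : Finset (DecTree Γ) :=
  (finite_support_G (form := form) hpos β).toFinset

theorem coeff_treeTerm (hpos : S.IsPositive b) (α : Γ) (z : ℂ) (β : Fin m →₀ ℕ) :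
    coeff β (S.treeTerm b form α z) = ∑ T ∈ contributingTrees form hpos β,
      (pairQ form α (S.W form T) : ℂ) * coeff β (S.G b T z) := by
  rw [treeTerm, coeff_apply, treeSum,
    finsum_eq_sum_of_support_subset _ (s := contributingTrees form hpos β)]
  · simp only [coeff_smul]
  · intro T hT
    rw [Function.mem_support, coeff_smul] at hT
    simp only [contributingTrees, Set.Finite.coe_toFinset, Set.mem_ofPred_eq]
    refine ⟨fun h0 => hT ?_, z, right_ne_zero_of_mul hT⟩
    rw [h0, pairQ_zero, Rat.cast_zero, zero_mul]

theorem coeff_treeTermDeriv (hpos : S.IsPositive b) (α : Γ) (z : ℂ) (β : Fin m →₀ ℕ) :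
    coeff β (S.treeTermDeriv b form α z) = ∑ T ∈ contributingTrees form hpos β,
      (pairQ form α (S.W form T) : ℂ) * deriv (fun w => coeff β (S.G b T w)) z := by
  rw [treeTermDeriv, coeff_apply, treeSum,
    finsum_eq_sum_of_support_subset _ (s := contributingTrees form hpos β)]
  · simp only [coeff_smul]
    rfl
  · intro T hT
    rw [Function.mem_support, coeff_smul] at hT
    simp only [contributingTrees, Set.Finite.coe_toFinset, Set.mem_ofPred_eq]
    refine ⟨fun h0 => hT ?_, ?_⟩
    · rw [h0, pairQ_zero, Rat.cast_zero, zero_mul]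
    · by_contra! h0
      refine hT ?_
      have : coeff β (derivCoeff (S.G b T) z) = 0 := by
        change deriv (fun w => coeff β (S.G b T w)) z = 0
        simp only [h0, deriv_const']
      rw [this, mul_zero]

theorem L_add (z : ℂ) (α α' : Γ) : S.L z (α + α') = S.L z α + S.L z α' := by
  simp only [L, map_add]
  ring

/-- `log (X(z)(e_α) / e_α)`, as a homomorphism in `α`. -/
noncomputable def logX (form : Γ →ₗ[ℤ] Γ →ₗ[ℤ] ℤ) (hpos : S.IsPositive b) (z : ℂ) :
    Γ →+ MvPowerSeries (Fin m) ℂ :=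
  AddMonoidHom.mk' (fun α => C (S.L z α) - S.treeTerm b form α z) fun α α' => by
    ext β
    simp only [map_add, map_sub, L_add, coeff_treeTerm hpos, pairQ_add, Rat.cast_add, add_mul,
      Finset.sum_add_distrib]
    ring

theorem logX_apply (hpos : S.IsPositive b) (z : ℂ) (α : Γ) :
    logX form hpos z α = C (S.L z α) - S.treeTerm b form α z := rfl

theorem weightedSum_Phi (hpos : S.IsPositive b) (z : ℂ) (α : Fin m →₀ ℕ) :
    weightedSum (S.Phi b form z) α = logX form hpos z (ofExponent b α) := by
  rw [ofExponent, map_sum]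
  refine Finset.sum_congr rfl fun i _ => ?_
  rw [map_nsmul, ← Nat.cast_smul_eq_nsmul ℂ]
  rfl

theorem X_eq_expEndo (z : ℂ) : S.X b form z = expEndo (S.Phi b form z) := rfl

theorem X_monomial (hpos : S.IsPositive b) (z : ℂ) (α : Fin m →₀ ℕ) :
    S.X b form z (monomial α 1) =
      monomial α 1 * expStar (logX form hpos z (ofExponent b α)) := by
  rw [X_eq_expEndo, expEndo_monomial, weightedSum_Phi hpos]

theorem X_eElem (hpos : S.IsPositive b) (z : ℂ) {α : Γ} (hα : α ∈ posCone b) :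
    S.X b form z (eElem b α) = S.X0 b z α * expStar (-S.treeTerm b form α z) := by
  rw [X0, eElem_of_mem b hα, X_monomial hpos, ofExponent_exponent b hα, logX_apply,
    sub_eq_add_neg, expStar_add, expStar_C]
  ring

theorem X_bijective (z : ℂ) : Function.Bijective (S.X b form z) := expEndo_bijective _

/-! ### The derivative of the flat section -/

/-- `∂_z log X(z)(e_α)`. -/
noncomputable def dlogX (S : StabilityData Γ) (b : Module.Basis (Fin m) ℤ Γ)
    (form : Γ →ₗ[ℤ] Γ →ₗ[ℤ] ℤ) (z : ℂ) (α : Γ) : MvPowerSeries (Fin m) ℂ :=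
  C (deriv (fun w => S.L w α) z) - S.treeTermDeriv b form α z

theorem dlogX_zero (hpos : S.IsPositive b) (z : ℂ) : S.dlogX b form z 0 = 0 := by
  ext β
  simp [dlogX, L, coeff_treeTermDeriv hpos, zero_pairQ]

/-- `z` avoids the rays of the active charges of degree `≤ k`. -/
def AvoidsRays (S : StabilityData Γ) (b : Module.Basis (Fin m) ℤ Γ) (k : ℕ) (z : ℂ) : Prop :=
  ∀ γ, S.a γ ≠ 0 → latticeDegree b γ ≤ k → z ∉ S.ray γ

variable {k : ℕ} {z : ℂ}

/-- Only the root ray can obstruct holomorphy in the outer variable, and the root label has degree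
at most that of `β`. -/
theorem differentiableAt_coeff_G (hpos : S.IsPositive b) (hgen : S.IsGeneric form) (hz0 : z ≠ 0)
    (hz : S.AvoidsRays b k z) {β : Fin m →₀ ℕ} (hβ : β.degree ≤ k) {T : DecTree Γ}
    (hT : T ∈ contributingTrees form hpos β) :
    DifferentiableAt ℂ (fun w => coeff β (S.G b T w)) z := by
  classical
  simp only [contributingTrees, Set.Finite.mem_toFinset, Set.mem_ofPred_eq] at hT
  obtain ⟨hW, w, hw⟩ := hT
  have hadm := isAdmissible_of_W_ne_zero hW
  refine differentiableAt_coeff_propagator hpos hgen hadm hz0 (hz _ hadm.a_ne_zero ?_) β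
  rw [G, coeff_propagator hpos hadm] at hw
  have hβT : β = T.rep.totalExponent b := by
    by_contra h0
    exact hw (if_neg h0)
  rw [← exponent_degree b (hpos _ hadm.a_ne_zero)]
  have h1 := Finsupp.degree_mono (exponent_rootLabel_le (b := b) T.rep)
  rw [← hβT] at h1
  exact_mod_cast h1.trans hβ

theorem hasCoeffDerivAt_logX (hpos : S.IsPositive b) (hgen : S.IsGeneric form) (hz0 : z ≠ 0)
    (hz : S.AvoidsRays b k z) (α : Γ) :
    HasCoeffDerivAt k (fun w => logX form hpos w α) (S.dlogX b form z α) z := by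
  have hL : DifferentiableAt ℂ (fun w => S.L w α) z := by
    unfold L
    fun_prop (disch := exact hz0)
  refine HasCoeffDerivAt.sub (hasCoeffDerivAt_C hL.hasDerivAt) fun β hβ => ?_
  simp only [coeff_treeTerm hpos, coeff_treeTermDeriv hpos]
  exact HasDerivAt.fun_sum fun T hT =>
    (differentiableAt_coeff_G hpos hgen hz0 hz hβ hT).hasDerivAt.const_mul _

theorem hasCoeffDerivAt_X_monomial (hpos : S.IsPositive b) (hgen : S.IsGeneric form)
    (hz0 : z ≠ 0) (hz : S.AvoidsRays b k z) (α : Fin m →₀ ℕ) :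
    HasCoeffDerivAt k (fun w => S.X b form w (monomial α 1))
      (S.X b form z (monomial α 1) * S.dlogX b form z (ofExponent b α)) z := by
  simp only [X_monomial hpos]
  convert (hasCoeffDerivAt_const (monomial α 1)).mul
    (hasCoeffDerivAt_logX hpos hgen hz0 hz (ofExponent b α)).expStar using 1
  ring

theorem hasDerivAt_coeff_X (hpos : S.IsPositive b) (hgen : S.IsGeneric form) (hz0 : z ≠ 0)
    (hz : S.AvoidsRays b k z) {β : Fin m →₀ ℕ} (hβ : β.degree ≤ k)
    (f : MvPowerSeries (Fin m) ℂ) :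
    HasDerivAt (fun w => coeff β (S.X b form w f))
      (∑ α ∈ Finset.Iic β, coeff α f *
        coeff β (S.X b form z (monomial α 1) * S.dlogX b form z (ofExponent b α))) z := by
  simp only [X_eq_expEndo]
  rw [funext fun w => coeff_expEndo (S.Phi b form w) f β]
  exact HasDerivAt.fun_sum fun α _ =>
    (hasCoeffDerivAt_X_monomial hpos hgen hz0 hz α β hβ).const_mul _

theorem coeff_dX (hpos : S.IsPositive b) (hgen : S.IsGeneric form) (hz0 : z ≠ 0)
    (hz : S.AvoidsRays b k z) {β : Fin m →₀ ℕ} (hβ : β.degree ≤ k)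
    (f : MvPowerSeries (Fin m) ℂ) :
    coeff β (S.dX b form z f) = ∑ α ∈ Finset.Iic β, coeff α f *
      coeff β (S.X b form z (monomial α 1) * S.dlogX b form z (ofExponent b α)) :=
  (hasDerivAt_coeff_X hpos hgen hz0 hz hβ f).deriv

theorem hasCoeffDerivAt_X (hpos : S.IsPositive b) (hgen : S.IsGeneric form) (hz0 : z ≠ 0)
    (hz : S.AvoidsRays b k z) (f : MvPowerSeries (Fin m) ℂ) :
    HasCoeffDerivAt k (fun w => S.X b form w f) (S.dX b form z f) z := fun _ hβ =>
  (hasDerivAt_coeff_X hpos hgen hz0 hz hβ f).congr_deriv (coeff_dX hpos hgen hz0 hz hβ f).symm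

/-! ### The connection form -/

/-- `X(z)⁻¹`. -/
noncomputable def Xinv (S : StabilityData Γ) (b : Module.Basis (Fin m) ℤ Γ)
    (form : Γ →ₗ[ℤ] Γ →ₗ[ℤ] ℤ) (z : ℂ) :
    MvPowerSeries (Fin m) ℂ ≃ₐ[ℂ] MvPowerSeries (Fin m) ℂ :=
  (AlgEquiv.ofBijective (S.X b form z) (X_bijective z)).symm

theorem X_Xinv (f : MvPowerSeries (Fin m) ℂ) : S.X b form z (S.Xinv b form z f) = f :=
  (AlgEquiv.ofBijective (S.X b form z) (X_bijective z)).apply_symm_apply f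

theorem A_eq_dX_Xinv (f : MvPowerSeries (Fin m) ℂ) :
    S.A b form z f = S.dX b form z (S.Xinv b form z f) := by
  rw [A]
  congr 1
  apply (X_bijective (S := S) (b := b) (form := form) z).1
  rw [X_Xinv, Function.rightInverse_invFun (X_bijective z).2]

/-- ∂_z X is defined through `deriv`, which is additive only where the coefficients are
differentiable; hence the degree bound. -/
theorem coeff_A_add (hpos : S.IsPositive b) (hgen : S.IsGeneric form) (hz0 : z ≠ 0)
    (hz : S.AvoidsRays b k z) {β : Fin m →₀ ℕ} (hβ : β.degree ≤ k)
    (f g : MvPowerSeries (Fin m) ℂ) :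
    coeff β (S.A b form z (f + g)) = coeff β (S.A b form z f + S.A b form z g) := by
  simp only [A_eq_dX_Xinv, map_add]
  refine (hasCoeffDerivAt_X hpos hgen hz0 hz _).congr_coeff ?_ hβ |>.trans (map_add _ _ _)
  simp only [map_add]
  exact (hasCoeffDerivAt_X hpos hgen hz0 hz _).add (hasCoeffDerivAt_X hpos hgen hz0 hz _)

theorem coeff_A_mul (hpos : S.IsPositive b) (hgen : S.IsGeneric form) (hz0 : z ≠ 0)
    (hz : S.AvoidsRays b k z) {β : Fin m →₀ ℕ} (hβ : β.degree ≤ k)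
    (f g : MvPowerSeries (Fin m) ℂ) :
    coeff β (S.A b form z (f * g)) = coeff β (S.A b form z f * g + f * S.A b form z g) := by
  have h := (hasCoeffDerivAt_X hpos hgen hz0 hz (S.Xinv b form z f)).mul
    (hasCoeffDerivAt_X hpos hgen hz0 hz (S.Xinv b form z g))
  simp only [X_Xinv] at h
  simp only [A_eq_dX_Xinv]
  refine (hasCoeffDerivAt_X hpos hgen hz0 hz _).congr_coeff ?_ hβ
  simpa only [map_mul] using h

theorem coeff_A_C (hpos : S.IsPositive b) (hgen : S.IsGeneric form) (hz0 : z ≠ 0)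
    (hz : S.AvoidsRays b k z) {β : Fin m →₀ ℕ} (hβ : β.degree ≤ k)
    (c : ℂ) : coeff β (S.A b form z (C c)) = 0 := by
  rw [A_eq_dX_Xinv, ← map_zero (coeff β)]
  refine (hasCoeffDerivAt_X hpos hgen hz0 hz _).congr_coeff ?_ hβ
  simp only [c_eq_algebraMap, AlgEquiv.commutes, AlgHom.commutes]
  exact hasCoeffDerivAt_const _

/-- By Lagrange–Good, a coefficient of X⁻¹(f) depends only on coefficients of `f` at exponents below
it, so A descends to the truncation. -/
theorem coeff_A_eq_zero (hpos : S.IsPositive b) (hgen : S.IsGeneric form) (hz0 : z ≠ 0)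
    (hz : S.AvoidsRays b k z) {β : Fin m →₀ ℕ} (hβ : β.degree ≤ k)
    {f : MvPowerSeries (Fin m) ℂ}
    (hf : ∀ μ : Fin m →₀ ℕ, μ.degree ≤ k → coeff μ f = 0) : coeff β (S.A b form z f) = 0 := by
  rw [A_eq_dX_Xinv, coeff_dX hpos hgen hz0 hz hβ]
  refine Finset.sum_eq_zero fun α hα => ?_
  have hα' := (Finsupp.degree_mono (Finset.mem_Iic.1 hα)).trans hβ
  rw [← coeff_eq_coeff_det_mul_expEndo (S.Phi b form z), ← X_eq_expEndo, X_Xinv,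
    mul_right_comm, coeff_mul_eq_zero_of_le fun μ hμ =>
      hf μ ((Finsupp.degree_mono hμ).trans hα'), zero_mul]

/-- X(z) preserves constant terms, so their derivative vanishes. This compensates for the degree
lost to `∂_i` in `coeff_A`. -/
theorem constantCoeff_A (hpos : S.IsPositive b) (hgen : S.IsGeneric form) (hz0 : z ≠ 0)
    (hz : S.AvoidsRays b k z)
    (f : MvPowerSeries (Fin m) ℂ) : coeff 0 (S.A b form z f) = 0 := by
  rw [A_eq_dX_Xinv, coeff_dX hpos hgen hz0 hz (by simp)]
  refine Finset.sum_eq_zero fun α hα => ?_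
  obtain rfl : α = 0 := le_antisymm (Finset.mem_Iic.1 hα) zero_le
  simp [ofExponent, dlogX_zero hpos]

theorem coeff_A_coe (hpos : S.IsPositive b) (hgen : S.IsGeneric form) (hz0 : z ≠ 0)
    (hz : S.AvoidsRays b k z)
    (p : MvPolynomial (Fin m) ℂ) : ∀ β : Fin m →₀ ℕ, β.degree ≤ k →
    coeff β (S.A b form z p) =
      coeff β (∑ i, S.A b form z (MvPowerSeries.X i) * pderiv ℂ i (p : MvPowerSeries _ ℂ)) := by
  induction p using MvPolynomial.induction_on with
  | C c =>
    intro β hβ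
    simp [coeff_A_C hpos hgen hz0 hz hβ]
  | add p q hp hq =>
    intro β hβ
    rw [MvPolynomial.coe_add, coeff_A_add hpos hgen hz0 hz hβ, map_add, hp β hβ, hq β hβ]
    simp only [map_add, mul_add, Finset.sum_add_distrib]
  | mul_X p j hp =>
    intro β hβ
    rw [MvPolynomial.coe_mul, MvPolynomial.coe_X, coeff_A_mul hpos hgen hz0 hz hβ, map_add,
      mul_comm (S.A b form z p), coeff_mul_congr_of_degree_le hp hβ, ← map_add]
    congr 1
    have h : ∀ i, S.A b form z (MvPowerSeries.X i) *
        pderiv ℂ i ((p : MvPowerSeries _ ℂ) * MvPowerSeries.X j) =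
        MvPowerSeries.X j * (S.A b form z (MvPowerSeries.X i) * pderiv ℂ i p) +
          if i = j then p * S.A b form z (MvPowerSeries.X i) else 0 := fun i => by
      rw [Derivation.leibniz, pderiv_X, Pi.single_apply]
      simp only [smul_eq_mul, eq_comm (a := j)]
      split_ifs <;> ring
    rw [Finset.sum_congr rfl fun i _ => h i, Finset.sum_add_distrib, ← Finset.mul_sum]
    simp

/-- The Leibniz rule settles polynomials. The remainder of `f` starts in degree `k + 1`, its
derivatives in degree `k`, and multiplying by A(s_i), which has no constant term, pushes them past
`k`. -/
theorem coeff_A (hpos : S.IsPositive b) (hgen : S.IsGeneric form) (hz0 : z ≠ 0)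
    (hz : S.AvoidsRays b k z) {β : Fin m →₀ ℕ} (hβ : β.degree ≤ k)
    (f : MvPowerSeries (Fin m) ℂ) :
    coeff β (S.A b form z f) =
      coeff β (∑ i, S.A b form z (MvPowerSeries.X i) * pderiv ℂ i f) := by
  classical
  set p : MvPowerSeries (Fin m) ℂ := ((truncTotal (k + 1) f : MvPolynomial (Fin m) ℂ) :
    MvPowerSeries (Fin m) ℂ) with hp
  have hr : ∀ μ : Fin m →₀ ℕ, μ.degree ≤ k → coeff μ (f - p) = 0 := fun μ hμ => by
    rw [map_sub, hp, MvPolynomial.coeff_coe, coeff_truncTotal _ (by omega), sub_self]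
  have hzero : coeff β (∑ i, S.A b form z (MvPowerSeries.X i) * pderiv ℂ i (f - p)) = 0 := by
    rw [map_sum]
    refine Finset.sum_eq_zero fun i _ => ?_
    rw [coeff_mul]
    refine Finset.sum_eq_zero fun x hx => ?_
    have hdeg := congrArg Finsupp.degree (Finset.HasAntidiagonal.mem_antidiagonal.1 hx)
    rw [map_add] at hdeg
    by_cases hx0 : x.1 = 0
    · rw [hx0, constantCoeff_A hpos hgen hz0 hz, zero_mul]
    · have : x.1.degree ≠ 0 := by rwa [Ne, Finsupp.degree_eq_zero_iff]
      rw [coeff_pderiv, hr, zero_mul, mul_zero]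
      simp only [map_add, Finsupp.degree_single]
      omega
  rw [← add_sub_cancel p f, coeff_A_add hpos hgen hz0 hz hβ, map_add,
    coeff_A_eq_zero hpos hgen hz0 hz hβ hr, hp,
    coeff_A_coe hpos hgen hz0 hz _ β hβ, ← hp]
  simp only [map_add (pderiv ℂ _), mul_add, Finset.sum_add_distrib, map_add (coeff β), hzero]

/-- This is Lagrange–Good for `H = X⁻¹(s_i)`, whose image under X is `s_i`. -/
theorem goodCoeff_eq (z : ℂ) (i : Fin m) {α : Γ} (hα : α ∈ posCone b) :
    S.goodCoeff b form z i α = coeff (exponent b α) (S.Xinv b form z (MvPowerSeries.X i)) := by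
  rw [← coeff_eq_coeff_det_mul_expEndo (S.Phi b form z), ← X_eq_expEndo, X_Xinv, goodCoeff]
  have h : ∑ j, (b.repr α j : ℂ) • S.Phi b form z j =
      weightedSum (S.Phi b form z) (exponent b α) := by
    refine Finset.sum_congr rfl fun j _ => ?_
    rw [← exponent_cast b hα, Int.cast_natCast]
  rw [h]
  rfl

theorem hasSum_goodCoeff (hpos : S.IsPositive b) (hgen : S.IsGeneric form) (hz0 : z ≠ 0)
    (hz : S.AvoidsRays b k z) {β : Fin m →₀ ℕ} (hβ : β.degree ≤ k) (i : Fin m) :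
    HasSum (fun α : {α : Γ // α ∈ posCone b ∧ α ≠ 0} =>
        coeff β (S.goodCoeff b form z i α •
          (S.X b form z (eElem b (α : Γ)) * S.dlogX b form z α)))
      (coeff β (S.A b form z (eElem b (b i)))) := by
  classical
  let g : (Fin m →₀ ℕ) → ℂ := fun μ => coeff μ (S.Xinv b form z (MvPowerSeries.X i)) *
    coeff β (S.X b form z (monomial μ 1) * S.dlogX b form z (ofExponent b μ))
  have hg : HasSum g (coeff β (S.A b form z (eElem b (b i)))) := by
    rw [eElem_basis, A_eq_dX_Xinv, coeff_dX hpos hgen hz0 hz hβ]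
    refine hasSum_sum_of_ne_finset_zero fun μ hμ => ?_
    rw [Finset.mem_Iic] at hμ
    simp only [g]
    rw [X_monomial hpos, mul_assoc, coeff_monomial_mul, if_neg hμ, mul_zero]
  have hinj : Function.Injective
      fun α : {α : Γ // α ∈ posCone b ∧ α ≠ 0} => exponent b (α : Γ) := fun α α' h =>
    Subtype.ext (exponent_injOn b α.2.1 α'.2.1 h)
  refine ((hinj.hasSum_iff fun μ hμ => ?_).2 hg).congr_fun fun α => ?_
  -- The sum over all exponents differs from the one over nonzero charges only at 0, where the
  -- logarithmic derivative vanishes.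
  · have hμ0 : ofExponent b μ = 0 := by
      by_contra h0
      exact hμ ⟨⟨ofExponent b μ, ofExponent_mem b μ, h0⟩, exponent_ofExponent b μ⟩
    simp only [g, hμ0, dlogX_zero hpos, mul_zero, map_zero]
  · simp only [g, Function.comp, coeff_smul, goodCoeff_eq z i α.2.1, eElem_of_mem b α.2.1,
      ofExponent_exponent b α.2.1]

end StabilityData

theorem mainTheorem7 {Γ : Type*} [AddCommGroup Γ] {m : ℕ} (b : Module.Basis (Fin m) ℤ Γ)
    (form : Γ →ₗ[ℤ] Γ →ₗ[ℤ] ℤ) (hform : ∀ γ η, form γ η = - form η γ)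
    (S : StabilityData Γ) (hpos : S.IsPositive b) (hgen : S.IsGeneric form) :
    -- the sums over trees are finite in each coefficient
    (∀ β : Fin m →₀ ℕ,
      {T : DecTree Γ | S.W form T ≠ 0 ∧ ∃ z, coeff β (S.G b T z) ≠ 0}.Finite) ∧
    -- the graph integrals which occur converge, and are holomorphic off the ray of the root
    (∀ T : DecTree Γ, S.W form T ≠ 0 → ∀ z : ℂ, z ≠ 0 → z ∉ S.ray T.rep.rootLabel →
      ∀ β : Fin m →₀ ℕ,
        IntegrableOn (S.propagatorIntegrand b T.rep β z) (Set.Ioi 0) ∧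
        DifferentiableAt ℂ (fun w => coeff β (S.G b T w)) z) ∧
    ∀ z : ℂ, z ≠ 0 →
      -- `X(z)` is an automorphism, given by the sum over trees
      Function.Bijective (S.X b form z) ∧
      (∀ α ∈ posCone b,
        S.X b form z (eElem b α) = S.X0 b z α * expStar (- S.treeTerm b form α z)) ∧
      -- modulo terms of degree `> k`, away from the finitely many rays active in degree `≤ k`
      ∀ k : ℕ, (∀ γ, S.a γ ≠ 0 → latticeDegree b γ ≤ k → z ∉ S.ray γ) →
        ∀ β : Fin m →₀ ℕ, β.degree ≤ k →
          -- `X` is holomorphic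
          (∀ f, DifferentiableAt ℂ (fun w => coeff β (S.X b form w f)) z) ∧
          -- `A = ∑ᵢ A(e_{γᵢ}) ∂ᵢ`
          (∀ f, coeff β (S.A b form z f) =
            coeff β (∑ i, S.A b form z (eElem b (b i)) * pderiv ℂ i f)) ∧
          -- the explicit formula for `A(e_{γᵢ})`
          ∀ i, HasSum
            (fun α : {α : Γ // α ∈ posCone b ∧ α ≠ 0} =>
              coeff β (S.goodCoeff b form z i α •
                (S.X b form z (eElem b (α : Γ)) *
                  (C (deriv (fun w => S.L w (α : Γ)) z) - S.treeTermDeriv b form α z))))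
            (coeff β (S.A b form z (eElem b (b i)))) := by

  refine ⟨StabilityData.finite_support_G hpos, fun T hT z hz0 hz β => ?_, fun z hz0 =>
    ⟨StabilityData.X_bijective z, fun α hα => StabilityData.X_eElem hpos z hα,
      fun k hk β hβ => ⟨fun f => ?_, fun f => ?_, fun i => ?_⟩⟩⟩
  · have hadm := StabilityData.isAdmissible_of_W_ne_zero hT
    exact ⟨hadm.integrableOn_propagatorIntegrand hpos hgen _ z hz0 hz β,
      StabilityData.differentiableAt_coeff_propagator hpos hgen hadm hz0 hz β⟩
  · exact (StabilityData.hasDerivAt_coeff_X hpos hgen hz0 hk hβ f).differentiableAt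
  · simp only [eElem_basis]
    exact StabilityData.coeff_A hpos hgen hz0 hk hβ f
  · exact StabilityData.hasSum_goodCoeff hpos hgen hz0 hk hβ i
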